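/- Let $H=L^2(\mathbb R)$ (complex valued, Lebesgue measure). Let $W^{1,2}(\mathbb R)\subseteq H$ be the space of (classes of) locally absolutely continuous functions in $L^2(\mathbb R)$ whose almost everywhere derivative is in $L^2(\mathbb R)$, and let $A=-i\frac{d}{dt}$ with domain $D(A)=W^{1,2}(\mathbb R)$. Let $\mathfrak L_A(H)$ be the space of linear operators $X:D(A)\to H$ for which there is $c$ with $\|Xx\|\le c(\|x\|+\|Ax\|)$ for all $x\in D(A)$; a bounded operator on $H$ is identified with its restriction to $D(A)$. Let $(T(t)x)(s)=x(s+t)$ and, for $f\in L^1(\mathbb R)$, $X\in\mathfrak L_A(H)$, $x\in D(A)$, put $$(\mathcal T(f)X)x=\int_{\mathbb R} f(t)\,T(-t)XT(t)x\,dt .$$ Let $\widehat f(\xi)=\int_{\mathbb R} f(t)e^{-it\xi}\,dt$. For $a>0$ let $\tau_a(\xi)=1$ for $|\xi|\le a$, $\tau_a(\xi)=\frac1a(2a-|\xi|)$ for $a<|\xi|<2a$, $\tau_a(\xi)=0$ for $|\xi|\ge 2a$; let $\omega_a(\xi)=\frac1\xi(1-\tau_a(\xi))$ (with $\omega_a(0)=0$);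 let $$\varphi_a(t)=\frac{2\sin\frac{3at}{2}\sin\frac{at}{2}}{\pi a t^2},$$ and let $\psi_a\in L^1(\mathbb R)$ be the function with $\widehat\psi_a=\omega_a$ (such a function exists). Denote by $\mathfrak S_2(H)$ the Hilbert–Schmidt operators on $H$ and by $\|\cdot\|_2$ both the Hilbert–Schmidt norm and the norm of $L^2(\mathbb R)$. Let $v\in L^2(\mathbb R)$ and let $V\in\mathfrak L_A(H)$ be the operator $(Vx)(t)=v(t)x(-t)$, $x\in D(A)$. Then, for every $a>0$: 1. $\mathcal T(\varphi_a)V\in\mathfrak S_2(H)$ and $\|\mathcal T(\varphi_a)V\|_2=\sqrt{\frac{2a}{3\pi}}\,\|v\|_2$. 2. $\mathcal T(\psi_a)V\in\mathfrak S_2(H)$ and $\|\mathcal T(\psi_a)V\|_2=\sqrt{\frac{1-\ln 2}{a\pi}}\,\|v\|_2$. 3. $\mathcal T(\psi_a)V\,(W^{1,2}(\mathbb R))\subseteq W^{1,2}(\mathbb R)$. 4. $V\,\mathcal T(\psi_a)V\in\mathfrak S_2(H)$ and $\|V\,\mathcal T(\psi_a)V\|_2\le\frac{\pi+1}{\pi\sqrt2}\,\|v\|_2^2$.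 Moreover: 5. For every $\epsilon>0$ there is $\lambda_\epsilon\in\mathbb C\setminus\mathbb R$ such that $\lambda_\epsilon-A$ has a bounded inverse and $\|V(\lambda_\epsilon-A)^{-1}\|<\epsilon$. -/

import Mathlib

open MeasureTheory Filter Topology

open scoped ENNReal

namespace ReflPert

noncomputable section

/-! ### Hilbert-Schmidt operators -/

section HilbertSchmidt

universe u

/-- The squared Hilbert-Schmidt norm `∑ ‖B eᵢ‖²` (possibly `∞`), computed in the Hilbert basis
`b = (eᵢ)`. -/
def hsSum {E : Type u} [NormedAddCommGroup E] [InnerProductSpace ℂ E] {ι : Type u}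
    (b : HilbertBasis ι ℂ E) (B : E →L[ℂ] E) : ℝ≥0∞ :=
  ∑' i, ‖B (b i)‖ₑ ^ 2

variable {E : Type u} [NormedAddCommGroup E] [InnerProductSpace ℂ E]

theorem hilbertBasis_parseval {ι : Type u} (b : HilbertBasis ι ℂ E) (x : E) :
    ‖x‖ₑ ^ 2 = ∑' i, ‖inner ℂ (b i) x‖ₑ ^ 2 := by
  have h : HasSum (fun i => ‖inner ℂ (b i) x‖ ^ 2) (‖x‖ ^ 2) := by
    have h1 := b.hasSum_inner_mul_inner x x
    have h2 : (fun i => inner ℂ x (b i) * inner ℂ (b i) x)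
        = fun i => ((‖inner ℂ (b i) x‖ ^ 2 : ℝ) : ℂ) := by
      funext i
      rw [← inner_conj_symm x (b i), RCLike.conj_mul]
      push_cast
      rfl
    rw [h2, inner_self_eq_norm_sq_to_K] at h1
    exact Complex.hasSum_ofReal.1 (by simpa using h1)
  have h3 : ∀ y : ℂ, ‖y‖ₑ ^ 2 = ENNReal.ofReal (‖y‖ ^ 2) := fun y => by
    rw [ENNReal.ofReal_pow (norm_nonneg _), ofReal_norm]
  have h4 : ‖x‖ₑ ^ 2 = ENNReal.ofReal (‖x‖ ^ 2) := by
    rw [ENNReal.ofReal_pow (norm_nonneg _), ofReal_norm]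
  simp_rw [h3]
  rw [h4, ← h.tsum_eq, ENNReal.ofReal_tsum_of_nonneg (fun _ => by positivity) h.summable]

/-- The Hilbert-Schmidt sum does not depend on the Hilbert basis. -/
theorem hsSum_eq [CompleteSpace E] {ι κ : Type u} (b : HilbertBasis ι ℂ E)
    (c : HilbertBasis κ ℂ E) (B : E →L[ℂ] E) : hsSum b B = hsSum c B := by
  have key : ∀ {ι κ : Type u} (b : HilbertBasis ι ℂ E) (c : HilbertBasis κ ℂ E),
      hsSum b B = ∑' j, ‖ContinuousLinearMap.adjoint B (c j)‖ₑ ^ 2 := by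
    intro ι κ b c
    unfold hsSum
    simp_rw [hilbertBasis_parseval c (B _)]
    rw [ENNReal.tsum_comm]
    congr 1
    funext j
    rw [hilbertBasis_parseval b]
    congr 1
    funext i
    rw [ContinuousLinearMap.adjoint_inner_right, ← ofReal_norm, ← ofReal_norm, norm_inner_symm]
  rw [key b c, key c c]

/-- The index set of a chosen Hilbert basis of `E`. -/
def stdIndex (E : Type u) [NormedAddCommGroup E] [InnerProductSpace ℂ E] [CompleteSpace E] :
    Set E := (exists_hilbertBasis ℂ E).choose

/-- A chosen Hilbert basis of `E`. -/
def stdBasis (E : Type u) [NormedAddCommGroup E] [InnerProductSpace ℂ E] [CompleteSpace E] :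
    HilbertBasis (stdIndex E) ℂ E := (exists_hilbertBasis ℂ E).choose_spec.choose

/-- `B` is a Hilbert-Schmidt operator. -/
def IsHilbertSchmidt [CompleteSpace E] (B : E →L[ℂ] E) : Prop :=
  hsSum (stdBasis E) B < ∞

/-- The Hilbert-Schmidt norm of a Hilbert-Schmidt operator. -/
def hsNorm [CompleteSpace E] (B : E →L[ℂ] E) : ℝ :=
  Real.sqrt (hsSum (stdBasis E) B).toReal

end HilbertSchmidt

/-! ### Operators bounded relative to an unbounded operator -/

section RelativelyBounded

variable {E : Type*} [NormedAddCommGroup E] [InnerProductSpace ℂ E]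

/-- The space `𝔏_A(E)` of linear operators with domain `D(A)` that are `A`-bounded. -/
def ABounded (A : E →ₗ.[ℂ] E) : Submodule ℂ (A.domain →ₗ[ℂ] E) where
  carrier := {X | ∃ c : ℝ, ∀ x : A.domain, ‖X x‖ ≤ c * (‖(x : E)‖ + ‖A x‖)}
  zero_mem' := ⟨0, fun x => by simp⟩
  add_mem' := by
    rintro X Y ⟨c, hc⟩ ⟨d, hd⟩
    refine ⟨c + d, fun x => (norm_add_le _ _).trans ?_⟩
    have := hc x
    have := hd x
    linarith
  smul_mem' := by
    rintro k X ⟨c, hc⟩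
    refine ⟨‖k‖ * c, fun x => ?_⟩
    rw [LinearMap.smul_apply, norm_smul, mul_assoc]
    exact mul_le_mul_of_nonneg_left (hc x) (norm_nonneg k)

/-- The restriction of a bounded operator to `D(A)`; for densely defined `A` this identifies the
bounded operators with a subspace of `𝔏_A(E)`. -/
def ofBounded (A : E →ₗ.[ℂ] E) (B : E →L[ℂ] E) : ABounded A :=
  ⟨B.toLinearMap ∘ₗ A.domain.subtype, ‖B‖, fun x =>
    (B.le_opNorm x).trans (mul_le_mul_of_nonneg_left (by simp) (norm_nonneg B))⟩

/-- `R` is the resolvent `(z - A)⁻¹`: a bounded operator with range in `D(A)` that is a two-sided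
inverse of `z - A : D(A) → E`. -/
structure IsResolvent (A : E →ₗ.[ℂ] E) (z : ℂ) (R : E →L[ℂ] E) : Prop where
  mem_domain : ∀ x, R x ∈ A.domain
  right_inv : ∀ x, z • R x - A ⟨R x, mem_domain x⟩ = x
  left_inv : ∀ x : A.domain, R (z • (x : E) - A x) = x

end RelativelyBounded

/-! ### The Sobolev space and the operator `A = -i d/dt` -/

/-- `L²(ℝ)`, complex valued. -/
abbrev L2 : Type := Lp ℂ 2 (volume : Measure ℝ)

/-- `L¹(ℝ)`, complex valued. -/
abbrev L1 : Type := Lp ℂ 1 (volume : Measure ℝ)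

/-- Absolute continuity on every bounded interval. -/
def LocAC (f : ℝ → ℂ) : Prop := ∀ a b : ℝ, AbsolutelyContinuousOnInterval f a b

namespace LocAC

variable {f g : ℝ → ℂ}

theorem continuous (hf : LocAC f) : Continuous f := by
  rw [continuous_iff_continuousAt]
  intro x
  have h := (hf (x - 1) (x + 1)).continuousOn
  rw [Set.uIcc_of_le (by linarith)] at h
  exact h.continuousAt (Icc_mem_nhds (by linarith) (by linarith))

theorem comp_clm (hf : LocAC f) (L : ℂ →L[ℝ] ℝ) (a b : ℝ) :
    AbsolutelyContinuousOnInterval (fun x => L (f x)) a b := by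
  have h := hf a b
  rw [absolutelyContinuousOnInterval_iff] at h ⊢
  intro ε hε
  obtain ⟨δ, hδ, H⟩ := h (ε / (‖L‖ + 1)) (by positivity)
  refine ⟨δ, hδ, fun E hE hE' => ?_⟩
  have h1 := H E hE hE'
  rw [lt_div_iff₀ (by positivity)] at h1
  refine lt_of_le_of_lt ?_ h1
  rw [Finset.sum_mul]
  refine Finset.sum_le_sum fun i _ => ?_
  rw [dist_eq_norm, dist_eq_norm, ← map_sub]
  refine (L.le_opNorm _).trans ?_
  rw [mul_comm]
  exact mul_le_mul_of_nonneg_left (by linarith) (norm_nonneg _)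

theorem ae_differentiableAt_real {u : ℝ → ℝ}
    (hu : ∀ a b : ℝ, AbsolutelyContinuousOnInterval u a b) : ∀ᵐ x, DifferentiableAt ℝ u x := by
  have h : ∀ᵐ x, ∀ n : ℕ, x ∈ Set.uIcc (-(n : ℝ)) n → DifferentiableAt ℝ u x :=
    ae_all_iff.2 fun n => (hu _ _).ae_differentiableAt
  filter_upwards [h] with x hx
  obtain ⟨n, hn⟩ := exists_nat_ge |x|
  refine hx n ?_
  rw [Set.uIcc_of_le (by linarith [abs_nonneg x])]
  exact abs_le.1 hn

theorem ae_differentiableAt (hf : LocAC f) : ∀ᵐ x, DifferentiableAt ℝ f x := by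
  filter_upwards [ae_differentiableAt_real (hf.comp_clm Complex.reCLM),
    ae_differentiableAt_real (hf.comp_clm Complex.imCLM)] with x h1 h2
  have h3 : f = fun y => Complex.ofRealCLM (Complex.reCLM (f y))
      + Complex.I • Complex.ofRealCLM (Complex.imCLM (f y)) := by
    funext y
    simp [mul_comm Complex.I]
  rw [h3]
  exact (Complex.ofRealCLM.differentiableAt.comp x h1).add
    ((Complex.ofRealCLM.differentiableAt.comp x h2).const_smul Complex.I)

theorem zero : LocAC 0 := fun a b => by
  simpa using! (LipschitzOnWith.absolutelyContinuousOnInterval (a := a) (b := b)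
    (LipschitzWith.const (0 : ℂ)).lipschitzOnWith)

theorem add (hf : LocAC f) (hg : LocAC g) : LocAC (f + g) := fun a b => (hf a b).add (hg a b)

theorem smul (c : ℂ) (hf : LocAC f) : LocAC (c • f) := fun a b => (hf a b).const_smul c

theorem comp_add (hf : LocAC f) (t : ℝ) : LocAC (fun s => f (s + t)) := by
  intro a b
  have h := hf (a + t) (b + t)
  rw [absolutelyContinuousOnInterval_iff] at h ⊢
  intro ε hε
  obtain ⟨δ, hδ, H⟩ := h ε hε
  refine ⟨δ, hδ, fun E hE hE' => ?_⟩
  refine H (E.1, fun i => ((E.2 i).1 + t, (E.2 i).2 + t)) ⟨fun i hi => ?_, ?_⟩ (by simpa using hE')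
  · have := hE.1 i hi
    simp only [Set.mem_uIcc] at this ⊢
    grind
  · intro i hi j hj hij
    have := hE.2 hi hj hij
    simp only [Function.onFun, Set.disjoint_left, Set.mem_uIoc] at this ⊢
    intro z h1 h2
    refine @this (z - t) ?_ ?_ <;> grind

theorem deriv_add_ae (hf : LocAC f) (hg : LocAC g) :
    deriv (f + g) =ᵐ[volume] deriv f + deriv g := by
  filter_upwards [hf.ae_differentiableAt, hg.ae_differentiableAt] with x h1 h2
  exact deriv_add h1 h2

theorem deriv_smul_ae (c : ℂ) (hf : LocAC f) : deriv (c • f) =ᵐ[volume] c • deriv f := by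
  filter_upwards [hf.ae_differentiableAt] with x h1
  exact deriv_const_smul c h1

theorem intervalIntegral_deriv (hf : LocAC f) (h2 : MemLp (deriv f) 2) (a b : ℝ) :
    ∫ x in a..b, deriv f x = f b - f a := by
  have hL : LocallyIntegrable (deriv f) volume := h2.locallyIntegrable (by norm_num)
  have hint : IntervalIntegrable (deriv f) volume a b :=
    hL.integrableOn_isCompact isCompact_uIcc |>.intervalIntegrable
  have key : ∀ L : ℂ →L[ℝ] ℝ, L (∫ x in a..b, deriv f x) = L (f b - f a) := by
    intro L
    rw [← L.intervalIntegral_comp_comm hint, map_sub,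
      ← (hf.comp_clm L a b).integral_deriv_eq_sub]
    refine intervalIntegral.integral_congr_ae ?_
    filter_upwards [hf.ae_differentiableAt] with x hx _
    exact (L.hasFDerivAt.comp_hasDerivAt x hx.hasDerivAt).deriv.symm
  exact Complex.ext (key Complex.reCLM) (key Complex.imCLM)

end LocAC

/-- `f` is the absolutely continuous representative of the class `x`, and its almost everywhere
derivative is square integrable. -/
structure IsRep (x : L2) (f : ℝ → ℂ) : Prop where
  locAC : LocAC f
  ae_eq : x =ᵐ[volume] f
  memLp_deriv : MemLp (deriv f) 2 volume

/-- The Sobolev space `W^{1,2}(ℝ)` as a subspace of `L²(ℝ)`. -/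
def W12 : Submodule ℂ L2 where
  carrier := {x | ∃ f, IsRep x f}
  zero_mem' := ⟨0, LocAC.zero, Lp.coeFn_zero _ _ _, by simp [show deriv (0 : ℝ → ℂ) = 0 by
    funext x; exact deriv_const x 0]⟩
  add_mem' := by
    rintro x y ⟨f, hf⟩ ⟨g, hg⟩
    exact ⟨f + g, hf.1.add hg.1, (Lp.coeFn_add x y).trans (hf.2.add hg.2),
      (hf.3.add hg.3).ae_eq (hf.1.deriv_add_ae hg.1).symm⟩
  smul_mem' := by
    rintro c x ⟨f, hf⟩
    exact ⟨c • f, hf.1.smul c, (Lp.coeFn_smul c x).trans (hf.2.const_smul c),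
      (hf.3.const_smul c).ae_eq (hf.1.deriv_smul_ae c).symm⟩

/-- The absolutely continuous representative of `x ∈ W^{1,2}(ℝ)`. -/
def rep (x : W12) : ℝ → ℂ := x.2.choose

theorem rep_spec (x : W12) : IsRep x (rep x) := x.2.choose_spec

theorem IsRep.unique {x : L2} {f g : ℝ → ℂ} (hf : IsRep x f) (hg : IsRep x g) : f = g :=
  (hf.1.continuous.ae_eq_iff_eq volume hg.1.continuous).1 (hf.2.symm.trans hg.2)

/-- The derivative `x' ∈ L²(ℝ)` of `x ∈ W^{1,2}(ℝ)`. -/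
def derivL2 (x : W12) : L2 := (rep_spec x).memLp_deriv.toLp (deriv (rep x))

theorem derivL2_ae {x : W12} {f : ℝ → ℂ} (hf : IsRep x f) : derivL2 x =ᵐ[volume] deriv f := by
  rw [← (rep_spec x).unique hf]
  exact MemLp.coeFn_toLp _

/-- The operator `A = -i d/dt` on `L²(ℝ)` with domain `W^{1,2}(ℝ)`. -/
abbrev opA : L2 →ₗ.[ℂ] L2 where
  domain := W12
  toFun :=
    { toFun := fun x => (-Complex.I) • derivL2 x
      map_add' := by
        intro x y
        rw [← smul_add]
        congr 1
        have hx := rep_spec x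
        have hy := rep_spec y
        have hxy : IsRep (x + y : W12) (rep x + rep y) :=
          ⟨hx.1.add hy.1, (Lp.coeFn_add (x : L2) y).trans (hx.2.add hy.2),
            (hx.3.add hy.3).ae_eq (hx.1.deriv_add_ae hy.1).symm⟩
        refine Lp.ext ?_
        exact ((derivL2_ae hxy).trans (hx.1.deriv_add_ae hy.1)).trans
          (((derivL2_ae hx).add (derivL2_ae hy)).symm.trans (Lp.coeFn_add _ _).symm)
      map_smul' := by
        intro c x
        rw [RingHom.id_apply, smul_comm]
        congr 1
        have hx := rep_spec x
        have hcx : IsRep (c • x : W12) (c • rep x) :=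
          ⟨hx.1.smul c, (Lp.coeFn_smul c (x : L2)).trans (hx.2.const_smul c),
            (hx.3.const_smul c).ae_eq (hx.1.deriv_smul_ae c).symm⟩
        refine Lp.ext ?_
        exact ((derivL2_ae hcx).trans (hx.1.deriv_smul_ae c)).trans
          (((derivL2_ae hx).const_smul c).symm.trans (Lp.coeFn_smul _ _).symm) }

theorem norm_opA (x : W12) : ‖opA x‖ = ‖derivL2 x‖ := by
  change ‖(-Complex.I) • derivL2 x‖ = _
  rw [norm_smul]
  simp

/-! ### Translations and the module structure on `𝔏_A(L²)` -/

/-- The translation group `(T(t)x)(s) = x(s + t)` on `L²(ℝ)`. -/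
def transl (t : ℝ) : L2 →ₗᵢ[ℂ] L2 :=
  Lp.compMeasurePreservingₗᵢ ℂ (fun s => s + t) (measurePreserving_add_right volume t)

theorem transl_ae (t : ℝ) (x : L2) : transl t x =ᵐ[volume] fun s => x (s + t) :=
  Lp.coeFn_compMeasurePreserving x (measurePreserving_add_right volume t)

theorem IsRep.transl {x : L2} {f : ℝ → ℂ} (hf : IsRep x f) (t : ℝ) :
    IsRep (transl t x) (fun s => f (s + t)) := by
  refine ⟨hf.1.comp_add t, (transl_ae t x).trans ?_, ?_⟩
  · exact (measurePreserving_add_right volume t).quasiMeasurePreserving.ae_eq_comp hf.2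
  · have : deriv (fun s => f (s + t)) = deriv f ∘ fun s => s + t := by
      funext s
      exact deriv_comp_add_const f t s
    rw [this]
    exact hf.3.comp_measurePreserving (measurePreserving_add_right volume t)

theorem transl_mem (t : ℝ) {x : L2} (hx : x ∈ W12) : transl t x ∈ W12 :=
  ⟨_, hx.choose_spec.transl t⟩

/-- The restriction of `T(t)` to `W^{1,2}(ℝ)`. -/
def translW (t : ℝ) : opA.domain →ₗ[ℂ] opA.domain :=
  (transl t).toLinearMap.restrict (p := W12) (q := W12) fun _ hx => transl_mem t hx

theorem derivL2_translW (t : ℝ) (x : W12) : derivL2 (translW t x) = transl t (derivL2 x) := by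
  refine Lp.ext ?_
  have hx := rep_spec x
  refine (derivL2_ae (x := translW t x) (hx.transl t)).trans
    (EventuallyEq.trans ?_ (transl_ae t (derivL2 x)).symm)
  have h := (measurePreserving_add_right volume t).quasiMeasurePreserving.ae_eq_comp
    (derivL2_ae hx)
  filter_upwards [h] with s hs
  rw [deriv_comp_add_const]
  exact hs.symm

theorem opA_translW (t : ℝ) (x : opA.domain) : opA (translW t x) = transl t (opA x) := by
  change (-Complex.I) • derivL2 (translW t x) = transl t ((-Complex.I) • derivL2 x)
  rw [map_smul]
  exact congrArg _ (derivL2_translW t x)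

theorem continuous_transl : Continuous fun p : ℝ × L2 => transl p.1 p.2 := by
  have h := Lp.compMeasurePreserving_continuous (μ := (volume : Measure ℝ))
    (ν := (volume : Measure ℝ)) (E := ℂ) (p := 2) (by norm_num)
  have h2 : Continuous fun t : ℝ => (⟨⟨fun s => s + t, by fun_prop⟩,
      measurePreserving_add_right volume t⟩ : {f : C(ℝ, ℝ) // MeasurePreserving f volume volume}) :=
    Continuous.subtype_mk (ContinuousMap.continuous_of_continuous_uncurry _ (by
      simp only [Function.uncurry_def]
      exact (continuous_snd.add continuous_fst))) _
  exact h.comp (continuous_snd.prodMk (h2.comp continuous_fst))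

/-- The representation `𝒯(t)X = T(t) X T(-t)` on `𝔏_A(L²)`. -/
def conjT (t : ℝ) (X : ABounded opA) : ABounded opA :=
  ⟨(transl t).toLinearMap ∘ₗ X.1 ∘ₗ translW (-t), by
    obtain ⟨c, hc⟩ := X.2
    refine ⟨c, fun x => ?_⟩
    have h := hc (translW (-t) x)
    rw [opA_translW, LinearIsometry.norm_map] at h
    have h' : ‖((translW (-t) x : opA.domain) : L2)‖ = ‖(x : L2)‖ := (transl (-t)).norm_map x
    change ‖transl t (X.1 (translW (-t) x))‖ ≤ _
    rw [LinearIsometry.norm_map]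
    rwa [h'] at h⟩

theorem continuous_conjT (X : ABounded opA) (x : opA.domain) :
    Continuous fun t : ℝ => (conjT (-t) X).1 x := by
  have h1 : Continuous fun t : ℝ => X.1 (translW t x) := by
    obtain ⟨c, hc⟩ := X.2
    rw [continuous_iff_continuousAt]
    intro t
    rw [ContinuousAt, tendsto_iff_norm_sub_tendsto_zero]
    have hT : ∀ y : L2, Tendsto (fun s => ‖transl s y - transl t y‖) (𝓝 t) (𝓝 0) := fun y =>
      tendsto_iff_norm_sub_tendsto_zero.1
        ((continuous_transl.comp (continuous_id.prodMk continuous_const)).tendsto t)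
    refine squeeze_zero (g := fun s => c * (‖transl s x - transl t x‖
      + ‖transl s (opA x) - transl t (opA x)‖)) (fun _ => norm_nonneg _) (fun s => ?_) ?_
    · have h := hc (translW s x - translW t x)
      rw [map_sub, LinearPMap.map_sub, opA_translW, opA_translW] at h
      exact h
    · simpa using ((hT x).add (hT (opA x))).const_mul c
  have h2 : (fun t : ℝ => (conjT (-t) X).1 x) = fun t => transl (-t) (X.1 (translW t x)) := by
    funext t
    change transl (-t) (X.1 (translW (- -t) x)) = _
    rw [neg_neg]
  rw [h2]
  exact continuous_transl.comp (continuous_neg.prodMk h1)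

theorem exists_bound_conjT (X : ABounded opA) :
    ∃ c : ℝ, ∀ (t : ℝ) (x : opA.domain), ‖(conjT (-t) X).1 x‖ ≤ c * (‖(x : L2)‖ + ‖opA x‖) := by
  obtain ⟨c, hc⟩ := X.2
  refine ⟨c, fun t x => ?_⟩
  have h := hc (translW (- -t) x)
  rw [opA_translW, LinearIsometry.norm_map] at h
  have h' : ‖((translW (- -t) x : opA.domain) : L2)‖ = ‖(x : L2)‖ := (transl (- -t)).norm_map x
  change ‖transl (-t) (X.1 (translW (- -t) x))‖ ≤ _
  rw [LinearIsometry.norm_map]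
  rwa [h'] at h

theorem integrable_action (f : L1) (X : ABounded opA) (x : opA.domain) :
    Integrable fun t : ℝ => f t • (conjT (-t) X).1 x := by
  obtain ⟨c, hc⟩ := exists_bound_conjT X
  exact (L1.integrable_coeFn f).smul_bdd (c * (‖(x : L2)‖ + ‖opA x‖))
    (continuous_conjT X x).aestronglyMeasurable (ae_of_all _ fun t => hc t x)

/-- The `L¹(ℝ)`-module structure `(𝒯(f)X)x = ∫ f(t) (𝒯(-t)X)x dt` on `𝔏_A(L²)`. -/
def action (f : L1) (X : ABounded opA) : ABounded opA :=
  ⟨{ toFun := fun x => ∫ t : ℝ, f t • (conjT (-t) X).1 x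
     map_add' := fun x y => by
      simp_rw [map_add, smul_add]
      exact integral_add (integrable_action f X x) (integrable_action f X y)
     map_smul' := fun c x => by
      simp_rw [map_smul, RingHom.id_apply, smul_comm (f _) c]
      exact integral_smul c _ }, by
    obtain ⟨c, hc⟩ := exists_bound_conjT X
    refine ⟨(∫ t, ‖f t‖) * c, fun x => ?_⟩
    rw [mul_assoc, ← integral_mul_const]
    refine norm_integral_le_of_norm_le ((L1.integrable_coeFn f).norm.mul_const _)
      (ae_of_all _ fun t => ?_)
    rw [norm_smul]
    exact mul_le_mul_of_nonneg_left (hc t x) (norm_nonneg _)⟩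

/-! ### The perturbation `V` -/

theorem setIntegral_norm_le (g : L2) (t : ℝ) : ∫ s in Set.Ioc t (t + 1), ‖g s‖ ≤ ‖g‖ := by
  have : IsProbabilityMeasure (volume.restrict (Set.Ioc t (t + 1))) := ⟨by simp⟩
  have hg : AEStronglyMeasurable g (volume.restrict (Set.Ioc t (t + 1))) :=
    (Lp.aestronglyMeasurable g).restrict
  have h1 : eLpNorm g 1 (volume.restrict (Set.Ioc t (t + 1))) ≤ eLpNorm g 2 volume :=
    (eLpNorm_le_eLpNorm_of_exponent_le (by norm_num) hg).trans
      (eLpNorm_mono_measure _ Measure.restrict_le_self)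
  rw [integral_norm_eq_lintegral_enorm hg, ← eLpNorm_one_eq_lintegral_enorm, Lp.norm_def]
  exact ENNReal.toReal_mono (Lp.eLpNorm_ne_top g) h1

theorem norm_rep_le (x : W12) (t : ℝ) : ‖rep x t‖ ≤ ‖(x : L2)‖ + ‖derivL2 x‖ := by
  have hx := rep_spec x
  have hint : ∀ g : L2, IntegrableOn (fun s => ‖g s‖) (Set.Ioc t (t + 1)) := fun g =>
    ((((Lp.memLp g).locallyIntegrable (by norm_num)).integrableOn_isCompact
      isCompact_Icc).mono_set Set.Ioc_subset_Icc_self).norm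
  have hx' : ∀ᵐ s ∂volume.restrict (Set.Ioc t (t + 1)),
      ‖rep x t‖ - ‖derivL2 x‖ ≤ ‖(x : L2) s‖ := by
    rw [ae_restrict_iff' measurableSet_Ioc]
    filter_upwards [hx.ae_eq] with s hs hst
    rw [hs]
    have h1 := hx.locAC.intervalIntegral_deriv hx.memLp_deriv t s
    have h2 : ‖∫ r in t..s, deriv (rep x) r‖ ≤ ‖derivL2 x‖ := by
      refine le_trans ?_ (setIntegral_norm_le (derivL2 x) t)
      rw [intervalIntegral.integral_of_le hst.1.le]
      refine (norm_integral_le_integral_norm _).trans ?_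
      have h3 : ∫ r in Set.Ioc t s, ‖deriv (rep x) r‖ = ∫ r in Set.Ioc t s, ‖derivL2 x r‖ :=
        integral_congr_ae (ae_restrict_of_ae ((derivL2_ae hx).symm.fun_comp norm))
      rw [h3]
      exact setIntegral_mono_set (hint _) (ae_of_all _ fun _ => norm_nonneg _)
        (Set.Ioc_subset_Ioc_right hst.2).eventuallyLE
    rw [h1] at h2
    have := norm_sub_norm_le (rep x t) (rep x s)
    rw [norm_sub_rev] at this
    linarith
  have h4 := integral_mono_ae (integrable_const _) (hint (x : L2)) hx'
  have h5 := setIntegral_norm_le (x : L2) t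
  simp at h4
  linarith

theorem ae_norm_mul_refl_le (v : L2) (x : W12) :
    ∀ᵐ t, ‖v t * (x : L2) (-t)‖ ≤ (‖(x : L2)‖ + ‖derivL2 x‖) * ‖v t‖ := by
  have h := (Measure.measurePreserving_neg (volume : Measure ℝ)).quasiMeasurePreserving.ae_eq_comp
    (rep_spec x).ae_eq
  filter_upwards [h] with t ht
  have ht' : (x : L2) (-t) = rep x (-t) := ht
  rw [ht', norm_mul, mul_comm]
  exact mul_le_mul_of_nonneg_right (norm_rep_le x _) (norm_nonneg _)

theorem memLp_mul_refl (v : L2) (x : W12) : MemLp (fun t => v t * (x : L2) (-t)) 2 volume := by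
  refine (Lp.memLp v).of_le_mul ?_ (ae_norm_mul_refl_le v x)
  exact (Lp.aestronglyMeasurable v).mul ((Lp.aestronglyMeasurable (x : L2)).comp_quasiMeasurePreserving
    (Measure.measurePreserving_neg (volume : Measure ℝ)).quasiMeasurePreserving)

/-- The operator `(Vx)(t) = v(t) x(-t)` with domain `D(A) = W^{1,2}(ℝ)`, as an element of
`𝔏_A(L²)`. -/
def opV (v : L2) : ABounded opA :=
  ⟨{ toFun := fun x => (memLp_mul_refl v x).toLp (fun t => v t * (x : L2) (-t))
     map_add' := fun x y => by
      rw [← MemLp.toLp_add, MemLp.toLp_eq_toLp_iff]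
      have h := (Measure.measurePreserving_neg
        (volume : Measure ℝ)).quasiMeasurePreserving.ae_eq_comp (Lp.coeFn_add (x : L2) y)
      filter_upwards [h] with t ht
      have ht' : ((x : L2) + (y : L2) : L2) (-t) = (x : L2) (-t) + (y : L2) (-t) := ht
      simp only [Submodule.coe_add, Pi.add_apply, ht', mul_add]
     map_smul' := fun c x => by
      rw [RingHom.id_apply, ← MemLp.toLp_const_smul, MemLp.toLp_eq_toLp_iff]
      have h := (Measure.measurePreserving_neg
        (volume : Measure ℝ)).quasiMeasurePreserving.ae_eq_comp (Lp.coeFn_smul c (x : L2))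
      filter_upwards [h] with t ht
      have ht' : (c • (x : L2) : L2) (-t) = c * (x : L2) (-t) := ht
      simp only [Submodule.coe_smul, Pi.smul_apply, ht', smul_eq_mul]
      ring }, by
    refine ⟨‖v‖, fun x => ?_⟩
    refine le_of_le_of_eq ?_ ((mul_comm _ _).trans
      (congrArg (fun r => ‖v‖ * (‖(x : L2)‖ + r)) (norm_opA x).symm))
    refine Lp.norm_le_mul_norm_of_ae_le_mul ?_
    filter_upwards [MemLp.coeFn_toLp (memLp_mul_refl v x), ae_norm_mul_refl_le v x] with t h1 h2
    exact h1 ▸ h2⟩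

/-! ### The auxiliary functions -/

/-- The Fourier transform `f̂(ξ) = ∫ f(t) e^{-itξ} dt` of `f ∈ L¹(ℝ)`. -/
def fourierL1 (f : L1) (ξ : ℝ) : ℂ := ∫ t : ℝ, f t * Complex.exp (-(Complex.I * t * ξ))

/-- The function `φ_a(t) = 2 sin(3at/2) sin(at/2) / (π a t²)`. -/
def phiFun (a t : ℝ) : ℝ :=
  2 * Real.sin (3 * a * t / 2) * Real.sin (a * t / 2) / (Real.pi * a * t ^ 2)

theorem memLp_phiFun (a : ℝ) : MemLp (fun t => (phiFun a t : ℂ)) 1 volume := by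
  rw [memLp_one_iff_integrable]
  suffices h : Integrable (phiFun a) from h.ofReal
  have hm : Measurable (phiFun a) := by unfold phiFun; fun_prop
  refine (integrable_inv_one_add_sq.const_mul
    (2 * (3 * a ^ 2 / 4 + 1) / (Real.pi * |a|))).mono' hm.aestronglyMeasurable
    (ae_of_all _ fun t => ?_)
  rcases eq_or_ne a 0 with rfl | ha
  · simp [phiFun]
  rcases eq_or_ne t 0 with rfl | ht
  · simp [phiFun]
    positivity
  have hs1 := Real.abs_sin_le_one (3 * a * t / 2)
  have hs2 := Real.abs_sin_le_one (a * t / 2)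
  have h1 : |Real.sin (3 * a * t / 2)| * |Real.sin (a * t / 2)| ≤ 1 :=
    mul_le_one₀ hs1 (abs_nonneg _) hs2
  have h2 : |Real.sin (3 * a * t / 2)| * |Real.sin (a * t / 2)| ≤ 3 * a ^ 2 / 4 * t ^ 2 := by
    refine (mul_le_mul (Real.abs_sin_le_abs) (Real.abs_sin_le_abs) (abs_nonneg _)
      (abs_nonneg _)).trans_eq ?_
    rw [← abs_mul, show 3 * a * t / 2 * (a * t / 2) = 3 * a ^ 2 / 4 * t ^ 2 by ring,
      abs_of_nonneg (by positivity)]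
  have ht2 : 0 < t ^ 2 := by positivity
  have ha' : 0 < |a| := abs_pos.2 ha
  rw [phiFun, Real.norm_eq_abs, abs_div, abs_mul, abs_mul, abs_mul, abs_mul,
    abs_of_pos Real.pi_pos, abs_of_pos ht2, ← div_eq_mul_inv, div_div, abs_two,
    div_le_div_iff₀ (by positivity) (by positivity)]
  have hp : 0 < Real.pi * |a| := by positivity
  have h3 : |Real.sin (3 * a * t / 2)| * |Real.sin (a * t / 2)| * (1 + t ^ 2)
      ≤ (3 * a ^ 2 / 4 + 1) * t ^ 2 := by nlinarith
  nlinarith [mul_le_mul_of_nonneg_left h3 hp.le]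

/-- `φ_a` as an element of `L¹(ℝ)`. -/
def phi (a : ℝ) : L1 := (memLp_phiFun a).toLp _

/-- The trapezoid function `τ_a`. -/
def tau (a ξ : ℝ) : ℝ :=
  if |ξ| ≤ a then 1 else if |ξ| < 2 * a then (2 * a - |ξ|) / a else 0

/-- The function `ω_a(ξ) = (1 - τ_a(ξ)) / ξ`, which vanishes for `|ξ| ≤ a`. -/
def omega (a ξ : ℝ) : ℝ := (1 - tau a ξ) / ξ

end

end ReflPert

open ReflPert

open ReflPert

namespace ReflPert

/-! ### Square integrable functions and Hilbert bases -/

/-! The whole theorem rests on one formula. Conjugating `V` by translations gives `(𝒯(f)Vx)(s) = ∫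
f(t) v(s-t) x(2t-s) dt` (`action_opV_ae`). The substitution `u = 2t - s` turns this into an integral
operator with kernel `½ f((s+u)/2) v((s-u)/2)`. The Hilbert-Schmidt norm of an integral operator is
the `L²` norm of its kernel (`exists_kernelOp`). Here its square is `¼ · 2 · ‖f‖² ‖v‖² = ½ ‖f‖²
‖v‖²` whenever `f ∈ L¹ ∩ L²` (`exists_action_opV`). The two exact norms then follow from Plancherel
(`lintegral_fourier_sq`) and the elementary integrals `∫ τ_a² = 8a/3` and `∫ ω_a² = (4 - 4 ln 2)/a`,
the Fourier convention contributing `1/(2π)`.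

The remaining claims about `ψ_a` need the function itself. Since `φ_a` is even with total mass
`τ_a(0) = 1`, the function `psiFun`, equal to the tail integral of `φ_a` for `t > 0` and to that
tail minus `1` for `t ≤ 0`, is odd off `0` and has distributional derivative `δ₀ - φ_a`. Integration
by parts gives it the Fourier transform `(1 - τ_a(ξ))/(iξ)`, so `ψ_a = i · psiFun`, and injectivity
of the Fourier transform makes every admissible `ψ` equal to this one almost everywhere.

Invariance of the Sobolev space is the commutator identity `A 𝒯(ψ_a)V - 𝒯(ψ_a)V A = V - 𝒯(φ_a)V`. In
the form `(𝒯(ψ_a)Vx)(s) = ∫ ψ_a(s-r) v(r) x(s-2r) dr` the factor `v` does not depend on `s`, so only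
`ψ_a` and `x` are differentiated, and the jump of `ψ_a` produces the term `Vx` (`psiFun_mul_sub`,
`action_psi_mem_W12`).

The operator `V 𝒯(ψ_a) V` has kernel `v(s) k(-s,u)` with `k` the kernel of `𝒯(ψ_a)V`. The bound
`|ψ_a| ≤ 1 + 1/π` leaves one factor `‖v‖²` for each variable in the squared norm.

For the last claim, `(iη - A)⁻¹` is convolution with a one-sided exponential of `L²` norm
`(2η)^(-1/2)`. It therefore maps `L²` to bounded functions with that norm at most, and
multiplication by `v` gives `‖V(iη - A)⁻¹‖ ≤ ‖v‖/√(2η)`, which tends to `0` as `η → ∞`. -/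

theorem secondCountable_L2 : SecondCountableTopology L2 := by
  have : Fact ((2 : ℝ≥0∞) ≠ ∞) := ⟨by norm_num⟩
  infer_instance

/-- Distinct basis vectors are at distance `√2`, so the balls of radius `1/2` around them are
disjoint open sets. Countability is what later permits exchanging the sum over the basis with an
integral. -/
theorem countable_of_hilbertBasis {E ι : Type*} [NormedAddCommGroup E] [InnerProductSpace ℂ E]
    [SecondCountableTopology E] (b : HilbertBasis ι ℂ E) : Countable ι := by
  have hd : (Set.univ : Set ι).PairwiseDisjoint fun i => Metric.ball (b i) (1 / 2) := by
    intro i _ j _ hij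
    refine Metric.ball_disjoint_ball ?_
    have h : ‖b i - b j‖ ^ 2 = 2 := by
      rw [@norm_sub_sq ℂ, b.orthonormal.2 hij, b.orthonormal.1, b.orthonormal.1]
      norm_num
    rw [dist_eq_norm]
    nlinarith [norm_nonneg (b i - b j)]
  exact Set.countable_univ_iff.1 (hd.countable_of_isOpen (fun _ _ => Metric.isOpen_ball)
    fun i _ => ⟨b i, Metric.mem_ball_self (by norm_num)⟩)

theorem eLpNorm_two_sq {α : Type*} [MeasurableSpace α] {μ : Measure α} (f : α → ℂ) :
    eLpNorm f 2 μ ^ 2 = ∫⁻ s, ‖f s‖ₑ ^ 2 ∂μ := by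
  rw [eLpNorm_eq_lintegral_rpow_enorm_toReal (by norm_num) (by norm_num), ← ENNReal.rpow_natCast,
    ← ENNReal.rpow_mul]
  norm_num

theorem L2_enorm_sq (x : L2) : ‖x‖ₑ ^ 2 = ∫⁻ s, ‖x s‖ₑ ^ 2 := by
  rw [Lp.enorm_def, eLpNorm_two_sq]

theorem L2_lintegral_lt_top (x : L2) : ∫⁻ s, ‖x s‖ₑ ^ 2 < ∞ := by
  rw [← L2_enorm_sq]
  exact ENNReal.pow_lt_top enorm_lt_top

theorem memLp_two_of_lintegral_lt_top {α : Type*} [MeasurableSpace α] {μ : Measure α} {f : α → ℂ}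
    (hf : AEStronglyMeasurable f μ) (h : ∫⁻ s, ‖f s‖ₑ ^ 2 ∂μ < ∞) : MemLp f 2 μ := by
  refine ⟨hf, ?_⟩
  rw [← eLpNorm_two_sq] at h
  by_contra h'
  rw [not_lt, top_le_iff] at h'
  simp [h'] at h

/-- The vector is the class of the complex conjugate of `g`. It makes Cauchy-Schwarz and Parseval
available for integrals that carry no conjugation. -/
theorem exists_riesz_of_memLp {g : ℝ → ℂ} (hg : MemLp g 2) :
    ∃ y : L2, ‖y‖ₑ ^ 2 = ∫⁻ u, ‖g u‖ₑ ^ 2 ∧ ∀ x : L2, ∫ u, g u * x u = inner ℂ y x := by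
  have hs := hg.star
  refine ⟨hs.toLp _, ?_, fun x => ?_⟩
  · rw [Lp.enorm_toLp, eLpNorm_two_sq]
    simp [Pi.star_apply]
  · rw [L2.inner_def]
    refine integral_congr_ae ?_
    filter_upwards [hs.coeFn_toLp] with u hu
    rw [hu, RCLike.inner_apply, Pi.star_apply]
    simp [mul_comm]

theorem enorm_integral_mul_sq_le {g : ℝ → ℂ} (hg : MemLp g 2) (x : L2) :
    ‖∫ u, g u * x u‖ₑ ^ 2 ≤ (∫⁻ u, ‖g u‖ₑ ^ 2) * ‖x‖ₑ ^ 2 := by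
  obtain ⟨y, hy, h⟩ := exists_riesz_of_memLp hg
  rw [h, ← hy, ← mul_pow]
  gcongr
  rw [← ofReal_norm, ← ofReal_norm, ← ofReal_norm, ← ENNReal.ofReal_mul (norm_nonneg _)]
  exact ENNReal.ofReal_le_ofReal (norm_inner_le_norm _ _)

theorem tsum_enorm_integral_mul_sq {ι : Type} (b : HilbertBasis ι ℂ L2) {g : ℝ → ℂ}
    (hg : MemLp g 2) : ∑' i, ‖∫ u, g u * b i u‖ₑ ^ 2 = ∫⁻ u, ‖g u‖ₑ ^ 2 := by
  obtain ⟨y, hy, h⟩ := exists_riesz_of_memLp hg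
  rw [← hy, hilbertBasis_parseval b]
  congr 1
  funext i
  rw [h, ← ofReal_norm, ← ofReal_norm, norm_inner_symm]

/-! ### Hilbert-Schmidt kernels -/

theorem stronglyMeasurable_integral_kernel {k : ℝ → ℝ → ℂ}
    (hk : StronglyMeasurable (Function.uncurry k)) (x : L2) :
    StronglyMeasurable fun s => ∫ u, k s u * x u :=
  StronglyMeasurable.integral_prod_right (f := fun s u => k s u * x u)
    (hk.mul ((Lp.stronglyMeasurable x).comp_measurable measurable_snd))

theorem memLp_row_ae {k : ℝ → ℝ → ℂ} (hk : StronglyMeasurable (Function.uncurry k))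
    (h : ∫⁻ s, ∫⁻ u, ‖k s u‖ₑ ^ 2 < ∞) : ∀ᵐ s, MemLp (k s) 2 := by
  have hm : Measurable fun s => ∫⁻ u, ‖k s u‖ₑ ^ 2 :=
    Measurable.lintegral_prod_right' (f := fun p : ℝ × ℝ => ‖k p.1 p.2‖ₑ ^ 2)
      (hk.measurable.enorm.pow_const 2)
  filter_upwards [ae_lt_top hm h.ne] with s hs
  exact memLp_two_of_lintegral_lt_top
    (hk.comp_measurable measurable_prodMk_left).aestronglyMeasurable hs

theorem lintegral_enorm_kernel_sq_le {k : ℝ → ℝ → ℂ}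
    (hk : StronglyMeasurable (Function.uncurry k))
    (h : ∫⁻ s, ∫⁻ u, ‖k s u‖ₑ ^ 2 < ∞) (x : L2) :
    ∫⁻ s, ‖∫ u, k s u * x u‖ₑ ^ 2 ≤ (∫⁻ s, ∫⁻ u, ‖k s u‖ₑ ^ 2) * ‖x‖ₑ ^ 2 := by
  rw [← lintegral_mul_const' _ _ (ENNReal.pow_ne_top enorm_ne_top)]
  refine lintegral_mono_ae ?_
  filter_upwards [memLp_row_ae hk h] with s hs using enorm_integral_mul_sq_le hs x

theorem memLp_kernel {k : ℝ → ℝ → ℂ} (hk : StronglyMeasurable (Function.uncurry k))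
    (h : ∫⁻ s, ∫⁻ u, ‖k s u‖ₑ ^ 2 < ∞) (x : L2) : MemLp (fun s => ∫ u, k s u * x u) 2 :=
  memLp_two_of_lintegral_lt_top (stronglyMeasurable_integral_kernel hk x).aestronglyMeasurable
    ((lintegral_enorm_kernel_sq_le hk h x).trans_lt
      (ENNReal.mul_lt_top h (ENNReal.pow_lt_top enorm_lt_top)))

/-- A square integrable kernel defines a Hilbert-Schmidt operator, whose Hilbert-Schmidt norm is
the `L²` norm of the kernel. -/
theorem exists_kernelOp {k : ℝ → ℝ → ℂ} (hk : StronglyMeasurable (Function.uncurry k))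
    (h : ∫⁻ s, ∫⁻ u, ‖k s u‖ₑ ^ 2 < ∞) :
    ∃ B : L2 →L[ℂ] L2, (∀ x : L2, B x =ᵐ[volume] fun s => ∫ u, k s u * x u) ∧
      hsSum (stdBasis L2) B = ∫⁻ s, ∫⁻ u, ‖k s u‖ₑ ^ 2 := by
  have hint : ∀ x : L2, ∀ᵐ s, Integrable fun u => k s u * x u := fun x => by
    filter_upwards [memLp_row_ae hk h] with s hs using hs.integrable_mul (Lp.memLp x)
  let B₀ : L2 →ₗ[ℂ] L2 :=
    { toFun := fun x => (memLp_kernel hk h x).toLp _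
      map_add' := fun x y => by
        rw [← MemLp.toLp_add, MemLp.toLp_eq_toLp_iff]
        filter_upwards [hint x, hint y] with s h1 h2
        rw [Pi.add_apply, ← integral_add h1 h2]
        refine integral_congr_ae ?_
        filter_upwards [Lp.coeFn_add x y] with u hu
        rw [hu, Pi.add_apply, mul_add]
      map_smul' := fun c x => by
        rw [RingHom.id_apply, ← MemLp.toLp_const_smul, MemLp.toLp_eq_toLp_iff]
        refine ae_of_all _ fun s => ?_
        rw [Pi.smul_apply, ← integral_smul]
        refine integral_congr_ae ?_
        filter_upwards [Lp.coeFn_smul c x] with u hu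
        rw [hu, Pi.smul_apply, smul_eq_mul, smul_eq_mul]
        ring }
  have hB₀ : ∀ x, B₀ x =ᵐ[volume] fun s => ∫ u, k s u * x u := fun x =>
    MemLp.coeFn_toLp (memLp_kernel hk h x)
  have hnorm : ∀ x, ‖B₀ x‖ₑ ^ 2 = ∫⁻ s, ‖∫ u, k s u * x u‖ₑ ^ 2 := fun x => by
    rw [L2_enorm_sq]
    refine lintegral_congr_ae ?_
    filter_upwards [hB₀ x] with s hs
    rw [hs]
  set N := ∫⁻ s, ∫⁻ u, ‖k s u‖ₑ ^ 2 with hN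
  have hle : ∀ x, ‖B₀ x‖ ≤ Real.sqrt N.toReal * ‖x‖ := fun x => by
    have h1 := (hnorm x).trans_le (lintegral_enorm_kernel_sq_le hk h x)
    have h2 := ENNReal.toReal_mono (ENNReal.mul_ne_top h.ne (ENNReal.pow_ne_top enorm_ne_top)) h1
    rw [ENNReal.toReal_mul, ENNReal.toReal_pow, ENNReal.toReal_pow, toReal_enorm, toReal_enorm]
      at h2
    refine le_of_sq_le_sq ?_ (by positivity)
    rwa [mul_pow, Real.sq_sqrt ENNReal.toReal_nonneg]
  refine ⟨B₀.mkContinuous _ hle, hB₀, ?_⟩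
  have := secondCountable_L2
  have := countable_of_hilbertBasis (stdBasis L2)
  unfold hsSum
  simp_rw [LinearMap.mkContinuous_apply, hnorm]
  -- The basis is countable, so the sum moves inside the integral over `s`; Parseval is then applied
  -- to each row `k s`.
  rw [← lintegral_tsum fun i =>
    ((stronglyMeasurable_integral_kernel hk _).measurable.enorm.pow_const 2).aemeasurable]
  refine lintegral_congr_ae ?_
  filter_upwards [memLp_row_ae hk h] with s hs using tsum_enorm_integral_mul_sq _ hs

/-! ### Bochner integrals in `L²` and pointwise integrals -/

theorem integrableOn_L2 (x : L2) {S : Set ℝ} (hS : volume S < ∞) : IntegrableOn x S :=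
  haveI : IsFiniteMeasure (volume.restrict S) := ⟨by simpa using hS⟩
  ((Lp.memLp x).restrict S).integrable (by norm_num)

theorem setIntegral_norm_L2_le (x : L2) {S : Set ℝ} (hS : volume S < ∞) :
    ∫ s in S, ‖x s‖ ≤ ‖x‖ * Real.sqrt (volume S).toReal := by
  have hx : AEStronglyMeasurable x (volume.restrict S) := (Lp.aestronglyMeasurable x).restrict
  have h1 := eLpNorm_le_eLpNorm_mul_rpow_measure_univ (p := 1) (q := 2) (by norm_num) hx
  have h2 : eLpNorm x 1 (volume.restrict S) ≤ eLpNorm x 2 volume * volume S ^ (1 / 2 : ℝ) := by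
    refine h1.trans ?_
    rw [Measure.restrict_apply_univ]
    refine (mul_le_mul_left (eLpNorm_mono_measure _ Measure.restrict_le_self) _).trans_eq ?_
    norm_num
  have h3 := ENNReal.toReal_mono (ENNReal.mul_ne_top (Lp.eLpNorm_ne_top x)
    (ENNReal.rpow_ne_top_of_nonneg (by norm_num) hS.ne)) h2
  rw [integral_norm_eq_lintegral_enorm hx, ← eLpNorm_one_eq_lintegral_enorm, Real.sqrt_eq_rpow,
    ENNReal.toReal_rpow, Lp.norm_def, ← ENNReal.toReal_mul]
  exact h3

section BochnerPointwise

variable {μ : Measure ℝ} {F : ℝ → L2} {K : ℝ → ℝ → ℂ}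

/-- On a set of finite measure the `L¹` norm is at most `√|S|` times the `L²` norm, so norm
integrability of `F` in `L²` yields joint integrability of `K`. This is the Fubini hypothesis for
`integral_L2_ae_eq`. -/
theorem integrable_prod_of_L2 (hF : Integrable F μ)
    (hK : StronglyMeasurable (Function.uncurry K)) (h : ∀ᵐ t ∂μ, F t =ᵐ[volume] K t)
    {S : Set ℝ} (hS : volume S < ∞) :
    Integrable (Function.uncurry K) (μ.prod (volume.restrict S)) := by
  rw [integrable_prod_iff hK.aestronglyMeasurable]
  constructor
  · filter_upwards [h] with t ht
    exact (integrableOn_L2 (F t) hS).congr (ae_restrict_of_ae ht)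
  · refine (hF.norm.mul_const (Real.sqrt (volume S).toReal)).mono'
      (hK.norm.integral_prod_right').aestronglyMeasurable ?_
    filter_upwards [h] with t ht
    rw [Real.norm_of_nonneg (integral_nonneg fun _ => norm_nonneg _)]
    refine le_of_eq_of_le ?_ (setIntegral_norm_L2_le (F t) hS)
    exact integral_congr_ae (ae_restrict_of_ae (ht.symm.fun_comp norm))

/-- Both sides have the same integral over every set `S` of finite measure: the Bochner integral
commutes with the inner product against the indicator of `S`, and Fubini treats the pointwise
integral. -/
theorem integral_L2_ae_eq [SFinite μ] (hF : Integrable F μ)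
    (hK : StronglyMeasurable (Function.uncurry K))
    (h : ∀ᵐ t ∂μ, F t =ᵐ[volume] K t) :
    (∫ t, F t ∂μ : L2) =ᵐ[volume] fun s => ∫ t, K t s ∂μ := by
  refine ae_eq_of_forall_setIntegral_eq_of_sigmaFinite (fun S _ hS => integrableOn_L2 _ hS)
    (fun S _ hS => (integrable_prod_of_L2 hF hK h hS).integral_prod_right) fun S hS hS' => ?_
  rw [← L2.inner_indicatorConstLp_one (𝕜 := ℂ) hS hS'.ne, ← integral_inner hF,
    ← integral_integral_swap (f := K) (integrable_prod_of_L2 hF hK h hS')]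
  refine integral_congr_ae ?_
  filter_upwards [h] with t ht
  rw [L2.inner_indicatorConstLp_one]
  exact integral_congr_ae (ae_restrict_of_ae ht)

end BochnerPointwise

/-! ### The action of `L¹` on the perturbation -/

theorem opV_ae (v : L2) (x : opA.domain) :
    (opV v).1 x =ᵐ[volume] fun t => v t * (x : L2) (-t) :=
  MemLp.coeFn_toLp (memLp_mul_refl v x)

/-- The reflection reverses the direction of a translation, so the two shifts around `V` add up
instead of cancelling. This is the origin of `2 * t`. -/
theorem conjT_opV_ae (v : L2) (x : opA.domain) (t : ℝ) :
    (conjT (-t) (opV v)).1 x =ᵐ[volume] fun s => v (s - t) * (x : L2) (2 * t - s) := by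
  have hq := (measurePreserving_add_right (volume : Measure ℝ) (-t)).quasiMeasurePreserving
  have h1 : (conjT (-t) (opV v)).1 x =ᵐ[volume] fun s => (opV v).1 (translW (- -t) x) (s + -t) :=
    transl_ae (-t) _
  have h2 := hq.ae_eq_comp (opV_ae v (translW (- -t) x))
  have h3 := (hq.ae_eq_comp ((Measure.measurePreserving_neg
    (volume : Measure ℝ)).quasiMeasurePreserving.ae_eq_comp (transl_ae (- -t) (x : L2))))
  filter_upwards [h1, h2, h3] with s e1 e2 e3
  have e2' : (opV v).1 (translW (- -t) x) (s + -t)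
    = v (s + -t) * (transl (- -t) (x : L2)) (-(s + -t)) := e2
  have e3' : (transl (- -t) (x : L2)) (-(s + -t)) = (x : L2) (-(s + -t) + - -t) := e3
  rw [e1, e2', e3']
  congr 2
  ring

theorem action_opV_ae (f : L1) (v : L2) (x : opA.domain) :
    (action f (opV v)).1 x =ᵐ[volume]
      fun s => ∫ t, f t * (v (s - t) * (x : L2) (2 * t - s)) := by
  refine integral_L2_ae_eq (K := fun t s => f t * (v (s - t) * (x : L2) (2 * t - s)))
    (integrable_action f (opV v) x) ?_ (ae_of_all _ fun t => ?_)
  · exact ((Lp.stronglyMeasurable f).comp_measurable measurable_fst).mul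
      (((Lp.stronglyMeasurable v).comp_measurable (measurable_snd.sub measurable_fst)).mul
      ((Lp.stronglyMeasurable (x : L2)).comp_measurable
        ((measurable_fst.const_mul 2).sub measurable_snd)))
  · filter_upwards [Lp.coeFn_smul (f t) ((conjT (-t) (opV v)).1 x), conjT_opV_ae v x t]
      with s h1 h2
    rw [h1, Pi.smul_apply, h2, smul_eq_mul]

/-- The kernel of `𝒯(f)V`. -/
noncomputable def actionKernel (f v : ℝ → ℂ) (s u : ℝ) : ℂ :=
  1 / 2 * (f ((s + u) / 2) * v ((s - u) / 2))

theorem stronglyMeasurable_actionKernel {f v : ℝ → ℂ} (hf : StronglyMeasurable f)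
    (hv : StronglyMeasurable v) : StronglyMeasurable (Function.uncurry (actionKernel f v)) :=
  ((hf.comp_measurable ((measurable_fst.add measurable_snd).div_const 2)).mul
    (hv.comp_measurable ((measurable_fst.sub measurable_snd).div_const 2))).const_mul (1 / 2)

theorem integral_comp_two_mul_sub (g : ℝ → ℂ) (s : ℝ) :
    ∫ t, g t = ∫ u, 1 / 2 * g ((s + u) / 2) := by
  have h1 : ∫ u, g ((s + u) / 2) = ∫ u, g (u / 2) :=
    integral_add_left_eq_self (fun u => g (u / 2)) s
  rw [integral_const_mul, h1, Measure.integral_comp_div]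
  simp

theorem lintegral_comp_mul_left (g : ℝ → ℝ≥0∞) {a : ℝ} (ha : a ≠ 0) :
    ∫⁻ u, g (a * u) = ENNReal.ofReal |a⁻¹| * ∫⁻ t, g t := by
  rw [← smul_eq_mul, ← lintegral_smul_measure, ← Real.map_volume_mul_left ha]
  exact ((Homeomorph.mulLeft₀ a ha).measurableEmbedding.lintegral_map (μ := volume) g).symm

theorem lintegral_comp_half_add (g : ℝ → ℝ≥0∞) (s : ℝ) :
    ∫⁻ u, g ((s + u) / 2) = 2 * ∫⁻ t, g t := by
  rw [lintegral_add_left_eq_self (fun u => g (u / 2)) s]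
  simp_rw [div_eq_inv_mul]
  rw [lintegral_comp_mul_left g (by norm_num), inv_inv, abs_two]
  norm_num

/-- The factor is `¼` from the kernel times the Jacobian `2` of `t = (s+u)/2`. The row by row form
also serves for `V 𝒯(ψ_a) V`, where `f` is estimated by its supremum instead of its `L²` norm. -/
theorem lintegral_actionKernel_row (f v : ℝ → ℂ) (s : ℝ) :
    ∫⁻ u, ‖actionKernel f v s u‖ₑ ^ 2 = 2⁻¹ * ∫⁻ t, ‖f t‖ₑ ^ 2 * ‖v (s - t)‖ₑ ^ 2 := by
  have h : ∀ u, ‖actionKernel f v s u‖ₑ ^ 2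
      = 4⁻¹ * (fun t => ‖f t‖ₑ ^ 2 * ‖v (s - t)‖ₑ ^ 2) ((s + u) / 2) := fun u => by
    have e : (1 / 2 : ℂ) = ((1 / 2 : ℝ) : ℂ) := by push_cast; rfl
    have e2 : ‖(1 / 2 : ℂ)‖ₑ ^ 2 = 4⁻¹ := by
      rw [← ofReal_norm, e, Complex.norm_real, ← ENNReal.ofReal_pow (norm_nonneg _),
        Real.norm_of_nonneg (by norm_num), show ((1 / 2 : ℝ)) ^ 2 = 4⁻¹ by norm_num,
        ENNReal.ofReal_inv_of_pos (by norm_num)]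
      simp
    rw [actionKernel, enorm_mul, enorm_mul, mul_pow, mul_pow, e2]
    congr 4
    ring_nf
  simp_rw [h]
  rw [lintegral_const_mul' _ _ (by simp),
    lintegral_comp_half_add (fun t => ‖f t‖ₑ ^ 2 * ‖v (s - t)‖ₑ ^ 2), ← mul_assoc]
  congr 1
  rw [show (4 : ℝ≥0∞) = 2 * 2 by norm_num, ENNReal.mul_inv (by simp) (by simp), mul_assoc,
    ENNReal.inv_mul_cancel (by norm_num) (by norm_num), mul_one]

theorem lintegral_actionKernel {f v : ℝ → ℂ} (hf : StronglyMeasurable f)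
    (hv : StronglyMeasurable v) : ∫⁻ s, ∫⁻ u, ‖actionKernel f v s u‖ₑ ^ 2
      = 2⁻¹ * ((∫⁻ t, ‖f t‖ₑ ^ 2) * ∫⁻ t, ‖v t‖ₑ ^ 2) := by
  simp_rw [lintegral_actionKernel_row]
  rw [lintegral_const_mul' _ _ (by simp), lintegral_lintegral_swap]
  · congr 1
    rw [← lintegral_mul_const _ (hf.measurable.enorm.pow_const 2)]
    refine lintegral_congr fun t => ?_
    rw [lintegral_const_mul' _ _ (by finiteness),
      lintegral_sub_right_eq_self (fun s => ‖v s‖ₑ ^ 2) t]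
  · have h1 : Measurable fun p : ℝ × ℝ => ‖f p.2‖ₑ ^ 2 * ‖v (p.1 - p.2)‖ₑ ^ 2 :=
      ((hf.measurable.comp measurable_snd).enorm.pow_const 2).mul
        ((hv.measurable.comp (measurable_fst.sub measurable_snd)).enorm.pow_const 2)
    exact h1.aemeasurable

theorem integral_action_eq_kernel (f v x : ℝ → ℂ) (s : ℝ) :
    ∫ t, f t * (v (s - t) * x (2 * t - s)) = ∫ u, actionKernel f v s u * x u := by
  rw [integral_comp_two_mul_sub _ s]
  refine integral_congr_ae (ae_of_all _ fun u => ?_)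
  simp only [actionKernel]
  rw [show s - (s + u) / 2 = (s - u) / 2 by ring, show 2 * ((s + u) / 2) - s = u by ring]
  ring

/-- If `f ∈ L¹ ∩ L²`, then `𝒯(f)V` is a Hilbert-Schmidt operator with Hilbert-Schmidt norm
`‖f‖₂ ‖v‖₂ / √2`. -/
theorem exists_action_opV (f : L1) (v : L2) (hf : ∫⁻ t, ‖f t‖ₑ ^ 2 < ∞) :
    ∃ B : L2 →L[ℂ] L2, ofBounded opA B = action f (opV v) ∧
      (∀ x : L2, B x =ᵐ[volume] fun s => ∫ t, f t * (v (s - t) * x (2 * t - s))) ∧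
      hsSum (stdBasis L2) B = 2⁻¹ * ((∫⁻ t, ‖f t‖ₑ ^ 2) * ∫⁻ t, ‖v t‖ₑ ^ 2) := by
  have hK := stronglyMeasurable_actionKernel (Lp.stronglyMeasurable f) (Lp.stronglyMeasurable v)
  have hN := lintegral_actionKernel (Lp.stronglyMeasurable f) (Lp.stronglyMeasurable v)
  obtain ⟨B, hB, hs⟩ := exists_kernelOp hK (by
    rw [hN]
    exact ENNReal.mul_lt_top (by simp) (ENNReal.mul_lt_top hf (L2_lintegral_lt_top v)))
  have hB' : ∀ x : L2, B x =ᵐ[volume] fun s => ∫ t, f t * (v (s - t) * x (2 * t - s)) :=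
    fun x => by
      simp_rw [integral_action_eq_kernel]
      exact hB x
  refine ⟨B, ?_, hB', hs.trans hN⟩
  refine Subtype.ext (LinearMap.ext fun x => Lp.ext ?_)
  exact (hB' x).trans (action_opV_ae f v x).symm

theorem isHilbertSchmidt_and_hsNorm {B : L2 →L[ℂ] L2} {c : ℝ} {v : L2} (hc : 0 ≤ c)
    (h : hsSum (stdBasis L2) B = ENNReal.ofReal c * ∫⁻ t, ‖v t‖ₑ ^ 2) :
    IsHilbertSchmidt B ∧ hsNorm B = Real.sqrt c * ‖v‖ := by
  rw [← L2_enorm_sq] at h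
  constructor
  · unfold IsHilbertSchmidt
    rw [h]
    exact ENNReal.mul_lt_top (by simp) (ENNReal.pow_lt_top enorm_lt_top)
  · unfold hsNorm
    rw [h, ENNReal.toReal_mul, ENNReal.toReal_pow, toReal_enorm, ENNReal.toReal_ofReal hc,
      Real.sqrt_mul hc, Real.sqrt_sq (norm_nonneg _)]

/-! ### Fourier transforms of integrable functions -/

section Fourier

open scoped FourierTransform SchwartzMap ContDiff

theorem fourier_eq_fourierL1 (f : L1) (w : ℝ) :
    𝓕 (f : ℝ → ℂ) w = fourierL1 f (2 * Real.pi * w) := by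
  rw [Real.fourier_real_eq_integral_exp_smul, fourierL1]
  refine integral_congr_ae (ae_of_all _ fun t => ?_)
  simp only [smul_eq_mul]
  rw [mul_comm]
  congr 2
  push_cast
  ring

theorem integral_schwartz_mul_fourier {f : ℝ → ℂ} (hf : Integrable f) (r : 𝓢(ℝ, ℂ)) :
    ∫ x, r x • 𝓕 f x = ∫ x, (𝓕 r : 𝓢(ℝ, ℂ)) x • f x := by
  have h := VectorFourier.integral_fourierIntegral_smul_eq_flip (μ := volume) (ν := volume)
    (L := innerₗ ℝ) (f := r) (g := f) Real.continuous_fourierChar continuous_inner r.integrable hf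
  rw [flip_innerₗ] at h
  refine h.symm.trans ?_
  rfl

/-- Smooth functions of compact support are Schwartz functions and already separate locally
integrable functions. -/
theorem ae_eq_of_integral_schwartz {f g : ℝ → ℂ} (hf : LocallyIntegrable f)
    (hg : LocallyIntegrable g) (h : ∀ r : 𝓢(ℝ, ℂ), ∫ x, r x • f x = ∫ x, r x • g x) :
    f =ᵐ[volume] g := by
  refine ae_eq_of_integral_contDiff_smul_eq hf hg fun r hr hr' => ?_
  have h1 : HasCompactSupport (Complex.ofRealCLM ∘ r) := hr'.comp_left rfl
  have h2 : ContDiff ℝ ∞ (Complex.ofRealCLM ∘ r) := by fun_prop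
  simpa using h (h1.toSchwartzMap h2)

/-- Every Schwartz function is the Fourier transform of a Schwartz function, so the multiplication
formula turns a test of `f` into a test of `𝓕 f`. -/
theorem fourier_ae_injective {f g : ℝ → ℂ} (hf : Integrable f) (hg : Integrable g)
    (h : 𝓕 f = 𝓕 g) : f =ᵐ[volume] g := by
  refine ae_eq_of_integral_schwartz hf.locallyIntegrable hg.locallyIntegrable fun r => ?_
  have e : (𝓕 (𝓕⁻ r : 𝓢(ℝ, ℂ)) : 𝓢(ℝ, ℂ)) = r := FourierTransform.fourier_fourierInv_eq r
  rw [← e, ← integral_schwartz_mul_fourier hf, ← integral_schwartz_mul_fourier hg, h]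

/-- **Plancherel** for an integrable function whose Fourier transform is square integrable. -/
theorem lintegral_fourier_sq {f : ℝ → ℂ} (hf : Integrable f) (h : MemLp (𝓕 f) 2) :
    ∫⁻ x, ‖f x‖ₑ ^ 2 = ∫⁻ x, ‖𝓕 f x‖ₑ ^ 2 := by
  -- The `L²` inverse transform of `𝓕 f`. Tested against Schwartz functions it agrees with `f`,
  -- after which the isometry of the `L²` Fourier transform applies to `y`.
  set y : L2 := 𝓕⁻ (h.toLp (𝓕 f)) with hy
  have hy' : 𝓕 y = h.toLp (𝓕 f) := FourierTransform.fourier_fourierInv_eq _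
  have hfy : f =ᵐ[volume] y := by
    refine ae_eq_of_integral_schwartz hf.locallyIntegrable
      ((Lp.memLp y).locallyIntegrable (by norm_num)) fun r => ?_
    have e : (𝓕 (𝓕⁻ r : 𝓢(ℝ, ℂ)) : 𝓢(ℝ, ℂ)) = r := FourierTransform.fourier_fourierInv_eq r
    rw [← e, ← integral_schwartz_mul_fourier hf]
    have h1 := Lp.toTemperedDistribution_apply y (𝓕 (𝓕⁻ r : 𝓢(ℝ, ℂ)))
    rw [← TemperedDistribution.fourier_apply, Lp.fourier_toTemperedDistribution_eq, hy',
      Lp.toTemperedDistribution_apply] at h1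
    rw [← h1]
    refine integral_congr_ae ?_
    filter_upwards [h.coeFn_toLp] with x hx
    rw [hx]
  have h2 : ‖y‖ₑ = ‖h.toLp (𝓕 f)‖ₑ := by
    rw [← hy', ← ofReal_norm, ← ofReal_norm, Lp.norm_fourier_eq]
  calc ∫⁻ x, ‖f x‖ₑ ^ 2 = ∫⁻ x, ‖y x‖ₑ ^ 2 := lintegral_congr_ae (by
        filter_upwards [hfy] with x hx
        rw [hx])
    _ = ‖h.toLp (𝓕 f)‖ₑ ^ 2 := by rw [← L2_enorm_sq, h2]
    _ = ∫⁻ x, ‖𝓕 f x‖ₑ ^ 2 := by rw [Lp.enorm_toLp, eLpNorm_two_sq]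

theorem fourierL1_injective {f g : L1} (h : ∀ ξ, fourierL1 f ξ = fourierL1 g ξ) : f = g := by
  refine Lp.ext (fourier_ae_injective (L1.integrable_coeFn f) (L1.integrable_coeFn g) ?_)
  funext w
  rw [fourier_eq_fourierL1, fourier_eq_fourierL1, h]

/-- The unitary transform `𝓕` at `w` is `fourierL1` at `2πw`; the dilation accounts for the factor
`1/(2π)`. -/
theorem lintegral_fourierL1_sq (f : L1) {g : ℝ → ℝ} (hf : ∀ ξ, fourierL1 f ξ = g ξ) {c : ℝ}
    (hc : ∫⁻ ξ, ‖g ξ‖ₑ ^ 2 = ENNReal.ofReal c) :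
    ∫⁻ t, ‖f t‖ₑ ^ 2 = ENNReal.ofReal (c / (2 * Real.pi)) := by
  have hpi : 0 < 2 * Real.pi := by positivity
  have h1 : ∫⁻ w, ‖𝓕 (f : ℝ → ℂ) w‖ₑ ^ 2 = ENNReal.ofReal (c / (2 * Real.pi)) := by
    simp_rw [fourier_eq_fourierL1, hf]
    have h2 : ∀ w, ‖((g (2 * Real.pi * w) : ℝ) : ℂ)‖ₑ = ‖g (2 * Real.pi * w)‖ₑ := fun w => by
      rw [← ofReal_norm, ← ofReal_norm, Complex.norm_real]
    simp_rw [h2]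
    rw [lintegral_comp_mul_left (fun ξ => ‖g ξ‖ₑ ^ 2) hpi.ne', hc,
      ← ENNReal.ofReal_mul (abs_nonneg _), abs_of_pos (inv_pos.2 hpi), div_eq_inv_mul]
  rw [← h1]
  refine lintegral_fourier_sq (L1.integrable_coeFn f) (memLp_two_of_lintegral_lt_top ?_ ?_)
  · exact (VectorFourier.fourierIntegral_continuous Real.continuous_fourierChar
      (L := innerₗ ℝ) continuous_inner (L1.integrable_coeFn f)).aestronglyMeasurable
  · rw [h1]
    exact ENNReal.ofReal_lt_top

end Fourier

/-! ### The functions `τ_a` and `ω_a` -/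

section TauOmega

variable {a : ℝ}

theorem tau_of_abs_le {ξ : ℝ} (h : |ξ| ≤ a) : tau a ξ = 1 := if_pos h

theorem tau_of_le_abs (ha : 0 < a) {ξ : ℝ} (h : 2 * a ≤ |ξ|) : tau a ξ = 0 := by
  rw [tau, if_neg (by linarith), if_neg (by linarith)]

theorem tau_of_mem_Icc (ha : 0 < a) {ξ : ℝ} (h : ξ ∈ Set.Icc a (2 * a)) :
    tau a ξ = (2 * a - ξ) / a := by
  have h0 : |ξ| = ξ := abs_of_nonneg (ha.le.trans h.1)
  rcases h.1.eq_or_lt with rfl | h1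
  · rw [tau_of_abs_le h0.le]
    field_simp
    ring
  rcases h.2.eq_or_lt with h2 | h2
  · rw [tau_of_le_abs ha (by rw [h0, h2]), h2]
    simp
  · rw [tau, if_neg (by rw [h0]; linarith), if_pos (by rwa [h0]), h0]

theorem tau_abs (a ξ : ℝ) : tau a |ξ| = tau a ξ := by simp only [tau, abs_abs]

theorem tau_eq_max_min (ha : 0 < a) (ξ : ℝ) :
    tau a ξ = max 0 (min 1 ((2 * a - |ξ|) / a)) := by
  unfold tau
  split_ifs with h1 h2
  · rw [min_eq_left (by rw [le_div_iff₀ ha]; linarith), max_eq_right zero_le_one]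
  · rw [min_eq_right (by rw [div_le_iff₀ ha]; linarith),
      max_eq_right (div_nonneg (by linarith) ha.le)]
  · rw [max_eq_left]
    exact (min_le_right _ _).trans (div_nonpos_of_nonpos_of_nonneg (by linarith) ha.le)

theorem continuous_tau (ha : 0 < a) : Continuous (tau a) := by
  rw [funext (tau_eq_max_min ha)]
  fun_prop

theorem tau_mem_Icc (ha : 0 < a) (ξ : ℝ) : tau a ξ ∈ Set.Icc (0 : ℝ) 1 := by
  rw [tau_eq_max_min ha]
  exact ⟨le_max_left _ _, max_le zero_le_one (min_le_left _ _)⟩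

theorem hasCompactSupport_tau (ha : 0 < a) : HasCompactSupport (tau a) :=
  HasCompactSupport.intro (isCompact_Icc (a := -(2 * a)) (b := 2 * a)) fun ξ hξ =>
    tau_of_le_abs ha (by
      by_contra h
      exact hξ (abs_le.1 (not_le.1 h).le))

theorem setIntegral_Ioi_zero_split {f : ℝ → ℝ} (hf : IntegrableOn f (Set.Ioi 0)) (ha : 0 < a) :
    ∫ y in Set.Ioi 0, f y
      = (∫ y in (0 : ℝ)..a, f y) + (∫ y in a..(2 * a), f y) + ∫ y in Set.Ioi (2 * a), f y := by
  have h1 := hf.mono_set (Set.Ioi_subset_Ioi ha.le)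
  have h2 := hf.mono_set (Set.Ioi_subset_Ioi (by linarith : 0 ≤ 2 * a))
  rw [add_assoc, intervalIntegral.integral_interval_add_Ioi h1 h2,
    intervalIntegral.integral_interval_add_Ioi hf h1]

theorem integrable_tau_sq (ha : 0 < a) : Integrable fun ξ => tau a ξ ^ 2 := by
  have h : HasCompactSupport fun ξ => tau a ξ * tau a ξ := (hasCompactSupport_tau ha).mul_right
  simp_rw [sq]
  exact ((continuous_tau ha).mul (continuous_tau ha)).integrable_of_hasCompactSupport h

/-- By evenness the integral is twice the contribution `a` of the plateau plus `a/3` of the slope.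
-/
theorem integral_tau_sq (ha : 0 < a) : ∫ ξ, tau a ξ ^ 2 = 8 * a / 3 := by
  have hint := integrable_tau_sq ha
  have h0 : ∫ ξ, tau a ξ ^ 2 = ∫ ξ, (fun y => tau a y ^ 2) |ξ| := by simp only [tau_abs]
  have h1 : ∫ y in (0 : ℝ)..a, tau a y ^ 2 = a := by
    rw [intervalIntegral.integral_congr (g := fun _ => (1 : ℝ))]
    · simp
    · intro y hy
      rw [Set.uIcc_of_le ha.le] at hy
      simp only [tau_of_abs_le (abs_le.2 ⟨by linarith [hy.1], hy.2⟩), one_pow]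
  have h2 : ∫ y in a..(2 * a), tau a y ^ 2 = a / 3 := by
    rw [intervalIntegral.integral_congr (g := fun y => ((2 * a - y) / a) ^ 2),
      intervalIntegral.integral_eq_sub_of_hasDerivAt
      (f := fun y => -(2 * a - y) ^ 3 / (3 * a ^ 2))]
    · field_simp
      ring
    · intro y _
      have h := ((((hasDerivAt_id y).const_sub (2 * a)).pow 3).neg).div_const (3 * a ^ 2)
      refine h.congr_deriv ?_
      simp only [id]
      field_simp
      ring
    · exact Continuous.intervalIntegrable (by fun_prop) _ _
    · intro y hy
      rw [Set.uIcc_of_le (by linarith)] at hy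
      simp only [tau_of_mem_Icc ha hy]
  have h3 : ∫ y in Set.Ioi (2 * a), tau a y ^ 2 = 0 := by
    refine setIntegral_eq_zero_of_forall_eq_zero fun y hy => ?_
    rw [tau_of_le_abs ha ((Set.mem_Ioi.1 hy).le.trans (le_abs_self y))]
    norm_num
  rw [h0, integral_comp_abs (f := fun y => tau a y ^ 2),
    setIntegral_Ioi_zero_split hint.integrableOn ha, h1, h2, h3]
  ring

/-- The boundary terms at `a` from the plateau and the slope cancel, leaving `(cos at - cos
2at)/(at²)` on each half-line; the product formula for a difference of cosines gives the two sines
of `phiFun`. -/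
theorem integral_tau_mul_cos (ha : 0 < a) {t : ℝ} (ht : t ≠ 0) :
    ∫ ξ, tau a ξ * Real.cos (t * ξ) = 2 * Real.pi * phiFun a t := by
  have hc : Continuous fun ξ => tau a ξ * Real.cos (t * ξ) :=
    (continuous_tau ha).mul (by fun_prop)
  have hint : Integrable fun ξ => tau a ξ * Real.cos (t * ξ) :=
    hc.integrable_of_hasCompactSupport (hasCompactSupport_tau ha).mul_right
  have h0 : ∫ ξ, tau a ξ * Real.cos (t * ξ)
      = ∫ ξ, (fun y => tau a y * Real.cos (t * y)) |ξ| := by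
    refine integral_congr_ae (ae_of_all _ fun ξ => ?_)
    simp only [tau_abs]
    rcases abs_cases ξ with ⟨h, _⟩ | ⟨h, _⟩ <;> simp [h]
  have h1 : ∫ y in (0 : ℝ)..a, tau a y * Real.cos (t * y) = Real.sin (t * a) / t := by
    rw [intervalIntegral.integral_congr (g := fun y => Real.cos (t * y)),
      intervalIntegral.integral_eq_sub_of_hasDerivAt (f := fun y => Real.sin (t * y) / t)]
    · simp
    · intro y _
      have h := (((hasDerivAt_id y).const_mul t).sin).div_const t
      refine h.congr_deriv ?_
      simp only [id]
      field_simp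
    · exact Continuous.intervalIntegrable (by fun_prop) _ _
    · intro y hy
      rw [Set.uIcc_of_le ha.le] at hy
      simp only [tau_of_abs_le (abs_le.2 ⟨by linarith [hy.1], hy.2⟩), one_mul]
  have h2 : ∫ y in a..(2 * a), tau a y * Real.cos (t * y)
      = -(Real.sin (t * a) / t) + (Real.cos (t * a) - Real.cos (t * (2 * a))) / (a * t ^ 2) := by
    rw [intervalIntegral.integral_congr (g := fun y => (2 * a - y) / a * Real.cos (t * y)),
      intervalIntegral.integral_eq_sub_of_hasDerivAt
        (f := fun y => (2 * a - y) / a * (Real.sin (t * y) / t) - Real.cos (t * y) / (a * t ^ 2))]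
    · field_simp
      ring
    · intro y _
      have h3 := (((hasDerivAt_id y).const_mul t).sin).div_const t
      have h4 := (((hasDerivAt_id y).const_mul t).cos).div_const (a * t ^ 2)
      have h5 := (((hasDerivAt_id y).const_sub (2 * a)).div_const a).mul h3
      refine (h5.sub h4).congr_deriv ?_
      simp only [id]
      field_simp
      ring
    · exact Continuous.intervalIntegrable (by fun_prop) _ _
    · intro y hy
      rw [Set.uIcc_of_le (by linarith)] at hy
      simp only [tau_of_mem_Icc ha hy]
  have h3 : ∫ y in Set.Ioi (2 * a), tau a y * Real.cos (t * y) = 0 := by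
    refine setIntegral_eq_zero_of_forall_eq_zero fun y hy => ?_
    rw [tau_of_le_abs ha ((Set.mem_Ioi.1 hy).le.trans (le_abs_self y)), zero_mul]
  have h4 : Real.cos (t * a) - Real.cos (t * (2 * a))
      = 2 * Real.sin (3 * a * t / 2) * Real.sin (a * t / 2) := by
    rw [Real.cos_sub_cos, show (t * a + t * (2 * a)) / 2 = 3 * a * t / 2 by ring,
      show (t * a - t * (2 * a)) / 2 = -(a * t / 2) by ring, Real.sin_neg]
    ring
  rw [h0, integral_comp_abs (f := fun y => tau a y * Real.cos (t * y)),
    setIntegral_Ioi_zero_split hint.integrableOn ha, h1, h2, h3, h4, phiFun]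
  have := Real.pi_ne_zero
  field_simp
  ring

theorem measurable_omega (ha : 0 < a) : Measurable (omega a) :=
  ((continuous_tau ha).measurable.const_sub 1).div measurable_id

theorem omega_sq_abs (a ξ : ℝ) : omega a |ξ| ^ 2 = omega a ξ ^ 2 := by
  rw [omega, omega, tau_abs, div_pow, div_pow, sq_abs]

theorem omega_of_abs_le {ξ : ℝ} (h : |ξ| ≤ a) : omega a ξ = 0 := by
  rw [omega, tau_of_abs_le h, sub_self, zero_div]

theorem integrable_omega_sq (ha : 0 < a) : Integrable fun ξ => omega a ξ ^ 2 := by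
  refine (integrable_inv_one_add_sq.const_mul (1 + 1 / a ^ 2)).mono'
    ((measurable_omega ha).pow_const 2).aestronglyMeasurable (ae_of_all _ fun ξ => ?_)
  rw [Real.norm_of_nonneg (sq_nonneg _)]
  rcases le_total |ξ| a with h | h
  · rw [omega_of_abs_le h, zero_pow two_ne_zero]
    -- The next case uses `|1 - τ_a| ≤ 1` together with `1 ≤ ξ²/a²`, which is how the constant `1 +
    -- 1/a²` in front of `1/(1+ξ²)` arises.
    positivity
  · have h1 : a ^ 2 ≤ ξ ^ 2 := by
      rw [← sq_abs ξ]
      exact pow_le_pow_left₀ ha.le h 2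
    have h2 : 0 < ξ ^ 2 := lt_of_lt_of_le (by positivity) h1
    have h3 := tau_mem_Icc ha ξ
    have h4 : (1 - tau a ξ) ^ 2 ≤ 1 := pow_le_one₀ (by linarith [h3.2]) (by linarith [h3.1])
    rw [omega, div_pow, ← div_eq_mul_inv]
    refine (div_le_div_of_nonneg_right h4 h2.le).trans ?_
    rw [div_le_div_iff₀ h2 (by positivity)]
    have h5 : 1 ≤ 1 / a ^ 2 * ξ ^ 2 := by
      rw [one_div_mul_eq_div, le_div_iff₀ (by positivity)]
      linarith
    linarith

/-- On `[a, 2a]` one has `ω_a(ξ) = 1/a - 1/ξ`, and beyond `2a` it is `1/ξ`. The half-line integral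
is `(3/2 - 2 ln 2)/a + 1/(2a)`, to be doubled. -/
theorem integral_omega_sq (ha : 0 < a) :
    ∫ ξ, omega a ξ ^ 2 = (4 - 4 * Real.log 2) / a := by
  have h0 : ∫ ξ, omega a ξ ^ 2 = ∫ ξ, (fun y => omega a y ^ 2) |ξ| := by simp only [omega_sq_abs]
  have h1 : ∫ y in (0 : ℝ)..a, omega a y ^ 2 = 0 := by
    rw [intervalIntegral.integral_congr (g := fun _ => (0 : ℝ))]
    · simp
    · intro y hy
      rw [Set.uIcc_of_le ha.le] at hy
      simp only [omega_of_abs_le (abs_le.2 ⟨by linarith [hy.1], hy.2⟩)]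
      norm_num
  have h2 : ∫ y in a..(2 * a), omega a y ^ 2 = (3 / 2 - 2 * Real.log 2) / a := by
    rw [intervalIntegral.integral_congr (g := fun y => (1 / a - 1 / y) ^ 2),
      intervalIntegral.integral_eq_sub_of_hasDerivAt
        (f := fun y => y / a ^ 2 - 2 / a * Real.log y - y⁻¹)]
    · rw [Real.log_mul (by norm_num) ha.ne']
      field_simp
      ring
    · intro y hy
      rw [Set.uIcc_of_le (by linarith)] at hy
      have hy0 : y ≠ 0 := (ha.trans_le hy.1).ne'
      have h3 := (((hasDerivAt_id y).div_const (a ^ 2)).sub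
        ((Real.hasDerivAt_log hy0).const_mul (2 / a))).sub (hasDerivAt_inv hy0)
      refine h3.congr_deriv ?_
      field_simp
      ring
    · refine ContinuousOn.intervalIntegrable fun y hy => ?_
      rw [Set.uIcc_of_le (by linarith)] at hy
      have hy0 : y ≠ 0 := (ha.trans_le hy.1).ne'
      exact ((continuousAt_const.sub (continuousAt_const.div continuousAt_id hy0)).pow
        2).continuousWithinAt
    · intro y hy
      rw [Set.uIcc_of_le (by linarith)] at hy
      have hy0 : y ≠ 0 := (ha.trans_le hy.1).ne'
      simp only [omega, tau_of_mem_Icc ha hy]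
      field_simp
      ring
  have h3 : ∫ y in Set.Ioi (2 * a), omega a y ^ 2 = 1 / (2 * a) := by
    have h2a : 0 < 2 * a := by linarith
    rw [setIntegral_congr_fun (g := fun y => y ^ (-2 : ℝ)) measurableSet_Ioi,
      integral_Ioi_rpow_of_lt (by norm_num) h2a]
    · norm_num
      rw [Real.rpow_neg_one]
      field_simp
    · intro y hy
      have hy0 : 0 < y := h2a.trans hy
      simp only [omega]
      rw [tau_of_le_abs ha ((Set.mem_Ioi.1 hy).le.trans (le_abs_self y)), Real.rpow_neg hy0.le]
      norm_num
  rw [h0, integral_comp_abs (f := fun y => omega a y ^ 2),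
    setIntegral_Ioi_zero_split (integrable_omega_sq ha).integrableOn ha, h1, h2, h3]
  field_simp
  ring

theorem lintegral_enorm_sq_eq {g : ℝ → ℝ} (hg : Integrable fun ξ => g ξ ^ 2) :
    ∫⁻ ξ, ‖g ξ‖ₑ ^ 2 = ENNReal.ofReal (∫ ξ, g ξ ^ 2) := by
  rw [ofReal_integral_eq_lintegral_ofReal hg (ae_of_all _ fun ξ => sq_nonneg _)]
  refine lintegral_congr fun ξ => ?_
  rw [← ofReal_norm, ← ENNReal.ofReal_pow (norm_nonneg _), Real.norm_eq_abs, sq_abs]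

theorem lintegral_tau_sq (ha : 0 < a) :
    ∫⁻ ξ, ‖tau a ξ‖ₑ ^ 2 = ENNReal.ofReal (8 * a / 3) := by
  rw [← integral_tau_sq ha]
  exact lintegral_enorm_sq_eq (integrable_tau_sq ha)

theorem lintegral_omega_sq (ha : 0 < a) :
    ∫⁻ ξ, ‖omega a ξ‖ₑ ^ 2 = ENNReal.ofReal ((4 - 4 * Real.log 2) / a) := by
  rw [← integral_omega_sq ha]
  exact lintegral_enorm_sq_eq (integrable_omega_sq ha)

end TauOmega

/-! ### The Fourier transform of `φ_a` -/

section Phi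

open scoped FourierTransform

variable {a : ℝ}

theorem phi_ae (a : ℝ) : phi a =ᵐ[volume] fun t => (phiFun a t : ℂ) := MemLp.coeFn_toLp _

theorem phiFun_neg (a t : ℝ) : phiFun a (-t) = phiFun a t := by
  rw [phiFun, phiFun, show 3 * a * -t / 2 = -(3 * a * t / 2) by ring,
    show a * -t / 2 = -(a * t / 2) by ring, Real.sin_neg, Real.sin_neg]
  ring

theorem fourierInv_tau (ha : 0 < a) {t : ℝ} (ht : t ≠ 0) :
    𝓕⁻ (fun w : ℝ => (tau a (2 * Real.pi * w) : ℂ)) t = phiFun a t := by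
  set h : ℝ → ℂ := fun ξ => (tau a ξ : ℂ) * Complex.exp (t * ξ * Complex.I) with hh
  have h1 : 𝓕⁻ (fun w : ℝ => (tau a (2 * Real.pi * w) : ℂ)) t = ∫ w, h (2 * Real.pi * w) := by
    rw [Real.fourierInv_eq']
    refine integral_congr_ae (ae_of_all _ fun w => ?_)
    simp only [hh, smul_eq_mul]
    rw [mul_comm]
    congr 2
    simp only [RCLike.inner_apply, conj_trivial]
    push_cast
    ring
  have hint : Integrable h := by
    refine Continuous.integrable_of_hasCompactSupport ?_ ?_
    · exact (Complex.continuous_ofReal.comp (continuous_tau ha)).mul (by fun_prop)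
    · exact ((hasCompactSupport_tau ha).comp_left Complex.ofReal_zero).mul_right
  have h2 : ∫ ξ, h ξ = ((2 * Real.pi * phiFun a t : ℝ) : ℂ) := by
    have h3 : ∫ ξ, h ξ = ∫ ξ, h (-ξ) := (integral_neg_eq_self h volume).symm
    -- Since `τ_a` is even, averaging the integral with its reflection replaces the exponential by a
    -- cosine.
    have h4 : 2 * ∫ ξ, h ξ = 2 * ((∫ ξ, tau a ξ * Real.cos (t * ξ) : ℝ) : ℂ) := by
      rw [two_mul]
      nth_rewrite 2 [h3]
      rw [← integral_add hint hint.comp_neg, ← integral_complex_ofReal, ← integral_const_mul]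
      refine integral_congr_ae (ae_of_all _ fun ξ => ?_)
      have h5 : tau a (-ξ) = tau a ξ := by simp only [tau, abs_neg]
      simp only [hh, h5]
      push_cast
      rw [Complex.cos]
      ring_nf
    rw [← integral_tau_mul_cos ha ht]
    exact mul_left_cancel₀ two_ne_zero h4
  have hpi : (Real.pi : ℂ) ≠ 0 := by exact_mod_cast Real.pi_ne_zero
  rw [h1, Measure.integral_comp_mul_left, h2, abs_of_pos (inv_pos.2 (by positivity)),
    Complex.real_smul]
  push_cast
  field_simp

/-- Fourier inversion applies at every point because `τ_a` is continuous and integrable and its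
inverse transform agrees almost everywhere with the integrable `phi a`. The point `t = 0`, where
`phiFun` takes the default value `0`, is negligible. -/
theorem fourierL1_phi (ha : 0 < a) (ξ : ℝ) : fourierL1 (phi a) ξ = tau a ξ := by
  set g : ℝ → ℂ := fun w => (tau a (2 * Real.pi * w) : ℂ) with hg
  have hc : Continuous g :=
    Complex.continuous_ofReal.comp ((continuous_tau ha).comp (continuous_const.mul continuous_id))
  have hgi : Integrable g := by
    have h0 : Integrable fun ξ => (tau a ξ : ℂ) :=
      ((continuous_tau ha).integrable_of_hasCompactSupport (hasCompactSupport_tau ha)).ofReal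
    exact h0.comp_mul_left' (by positivity)
  have hinv : 𝓕⁻ g =ᵐ[volume] phi a := by
    have h0 : ∀ᵐ t : ℝ, t ≠ 0 := Measure.ae_ne volume 0
    filter_upwards [h0, phi_ae a] with t ht h1
    rw [fourierInv_tau ha ht, h1]
  have hinvi : Integrable (𝓕⁻ g) := (L1.integrable_coeFn (phi a)).congr hinv.symm
  have hfi : Integrable (𝓕 g) := by
    have : 𝓕 g = fun w => 𝓕⁻ g (-w) := by
      funext w
      rw [Real.fourierInv_eq_fourier_neg, neg_neg]
    rw [this]
    exact hinvi.comp_neg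
  have h1 : 𝓕 (𝓕⁻ g) (ξ / (2 * Real.pi)) = g (ξ / (2 * Real.pi)) :=
    congrFun (hc.fourier_fourierInv_eq hgi hfi) _
  have h2 : 𝓕 (phi a : ℝ → ℂ) (ξ / (2 * Real.pi)) = 𝓕 (𝓕⁻ g) (ξ / (2 * Real.pi)) := by
    rw [Real.fourier_real_eq, Real.fourier_real_eq]
    refine integral_congr_ae ?_
    filter_upwards [hinv] with t ht
    rw [ht]
  have h3 : 2 * Real.pi * (ξ / (2 * Real.pi)) = ξ := by
    have := Real.pi_ne_zero
    field_simp
  rw [h1, fourier_eq_fourierL1, h3] at h2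
  rw [h2, hg]
  simp only [h3]

theorem integral_phiFun (ha : 0 < a) : ∫ t, phiFun a t = 1 := by
  have h := fourierL1_phi ha 0
  rw [tau_of_abs_le (by simpa using ha.le), fourierL1] at h
  have h2 : ∫ t, (phiFun a t : ℂ) = ((1 : ℝ) : ℂ) := by
    rw [← h]
    refine integral_congr_ae ?_
    filter_upwards [phi_ae a] with t ht
    rw [ht]
    simp
  rw [integral_complex_ofReal] at h2
  exact_mod_cast h2

end Phi

/-! ### The function `ψ_a` -/

section Psi

variable {a : ℝ}

theorem integrable_phiFun (a : ℝ) : Integrable (phiFun a) := by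
  simpa using (memLp_one_iff_integrable.1 (memLp_phiFun a)).re

theorem phiFun_eq_cos_sub_cos (a t : ℝ) :
    phiFun a t = (Real.cos (a * t) - Real.cos (2 * a * t)) / (Real.pi * a * t ^ 2) := by
  rw [phiFun, Real.cos_sub_cos, show (a * t + 2 * a * t) / 2 = 3 * a * t / 2 by ring,
    show (a * t - 2 * a * t) / 2 = -(a * t / 2) by ring, Real.sin_neg]
  ring

theorem abs_phiFun_le (ha : 0 < a) (t : ℝ) : |phiFun a t| ≤ 3 * a / (2 * Real.pi) := by
  rcases eq_or_ne t 0 with rfl | ht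
  · simp [phiFun]
    positivity
  have ht2 : 0 < t ^ 2 := by positivity
  have hp := Real.pi_pos
  have h1 : |Real.sin (3 * a * t / 2)| * |Real.sin (a * t / 2)| ≤ 3 * a ^ 2 / 4 * t ^ 2 := by
    refine (mul_le_mul (Real.abs_sin_le_abs) (Real.abs_sin_le_abs) (abs_nonneg _)
      (abs_nonneg _)).trans_eq ?_
    rw [← abs_mul, show 3 * a * t / 2 * (a * t / 2) = 3 * a ^ 2 / 4 * t ^ 2 by ring,
      abs_of_nonneg (by positivity)]
  rw [phiFun, abs_div, abs_mul, abs_mul, abs_two,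
    abs_of_pos (by positivity : 0 < Real.pi * a * t ^ 2),
    div_le_div_iff₀ (by positivity) (by positivity)]
  have h2 := mul_le_mul_of_nonneg_left h1 (by positivity : 0 ≤ 4 * Real.pi)
  calc _ = 4 * Real.pi * (|Real.sin (3 * a * t / 2)| * |Real.sin (a * t / 2)|) := by ring
    _ ≤ _ := h2
    _ = _ := by ring

theorem abs_phiFun_le_rpow (ha : 0 < a) {t : ℝ} (ht : 0 < t) :
    |phiFun a t| ≤ 2 / (Real.pi * a) * t ^ (-2 : ℝ) := by
  have hp := Real.pi_pos
  have h1 : |Real.sin (3 * a * t / 2)| * |Real.sin (a * t / 2)| ≤ 1 :=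
    mul_le_one₀ (Real.abs_sin_le_one _) (abs_nonneg _) (Real.abs_sin_le_one _)
  rw [phiFun, abs_div, abs_mul, abs_mul, abs_two,
    abs_of_pos (by positivity : 0 < Real.pi * a * t ^ 2),
    Real.rpow_neg ht.le, ← div_eq_mul_inv, div_div, Real.rpow_two, mul_assoc 2]
  exact div_le_div_of_nonneg_right (by linarith) (by positivity)

theorem continuousAt_phiFun (ha : 0 < a) {t : ℝ} (ht : t ≠ 0) : ContinuousAt (phiFun a) t := by
  have h : Real.pi * a * t ^ 2 ≠ 0 := by
    have := Real.pi_pos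
    positivity
  exact ContinuousAt.div (by fun_prop) (by fun_prop) h

/-- The tail integral of `φ_a`. -/
noncomputable def phiTail (a t : ℝ) : ℝ := ∫ s in Set.Ioi t, phiFun a s

theorem intervalIntegral_phiFun (a s t : ℝ) :
    ∫ u in s..t, phiFun a u = phiTail a s - phiTail a t :=
  eq_sub_of_add_eq (intervalIntegral.integral_interval_add_Ioi (integrable_phiFun a).integrableOn
    (integrable_phiFun a).integrableOn)

/-- Evenness of `φ_a` turns the tail from `-t` into the integral up to `t`, and the total mass is
`1`. -/
theorem phiTail_neg (ha : 0 < a) (t : ℝ) : phiTail a (-t) = 1 - phiTail a t := by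
  rw [phiTail, ← integral_comp_neg_Iic]
  simp_rw [phiFun_neg]
  rw [← integral_phiFun ha, ← intervalIntegral.integral_Iic_add_Ioi (b := t)
    (integrable_phiFun a).integrableOn (integrable_phiFun a).integrableOn, phiTail]
  ring

theorem phiTail_eq (a t : ℝ) : phiTail a t = phiTail a 0 - ∫ u in (0 : ℝ)..t, phiFun a u := by
  rw [intervalIntegral_phiFun]
  ring

theorem continuous_phiTail (a : ℝ) : Continuous (phiTail a) := by
  rw [funext (phiTail_eq a)]
  exact continuous_const.sub ((integrable_phiFun a).continuous_primitive 0)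

theorem hasDerivAt_phiTail (ha : 0 < a) {t : ℝ} (ht : t ≠ 0) :
    HasDerivAt (phiTail a) (-phiFun a t) t := by
  rw [funext (phiTail_eq a)]
  exact (intervalIntegral.integral_hasDerivAt_right (integrable_phiFun a).intervalIntegrable
    (integrable_phiFun a).aestronglyMeasurable.stronglyMeasurableAtFilter
    (continuousAt_phiFun ha ht)).const_sub _

theorem abs_phiTail_le_inv (ha : 0 < a) {t : ℝ} (ht : 0 < t) :
    |phiTail a t| ≤ 2 / (Real.pi * a) * t⁻¹ := by
  have h := norm_integral_le_of_norm_le (f := phiFun a)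
    ((integrableOn_Ioi_rpow_of_lt (by norm_num : (-2 : ℝ) < -1) ht).const_mul (2 / (Real.pi * a)))
    ((ae_restrict_iff' measurableSet_Ioi).2
      (ae_of_all _ fun s hs => abs_phiFun_le_rpow ha (ht.trans hs)))
  rw [integral_const_mul, integral_Ioi_rpow_of_lt (by norm_num) ht] at h
  refine h.trans_eq ?_
  norm_num
  left
  exact Real.rpow_neg_one t

/-- The scale separating the two regimes is `1/a`. Beyond it `|φ_a(s)| ≤ 2/(πas²)` bounds the tail
by `2/π`; the piece up to `1/a` adds at most `3/(2π)` through `|φ_a| ≤ 3a/(2π)`. The sum `7/(2π)` is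
below `1 + 1/π` because `π ≥ 5/2`. -/
theorem abs_phiTail_le (ha : 0 < a) {t : ℝ} (ht : 0 ≤ t) :
    |phiTail a t| ≤ 1 + 1 / Real.pi := by
  have hp := Real.pi_gt_three
  have hp0 := Real.pi_pos
  have key : ∀ s, a⁻¹ ≤ s → |phiTail a s| ≤ 2 / Real.pi := fun s hs => by
    have hs0 : 0 < s := (inv_pos.2 ha).trans_le hs
    refine (abs_phiTail_le_inv ha hs0).trans ?_
    rw [← div_eq_mul_inv, div_div]
    refine div_le_div_of_nonneg_left (by norm_num) hp0 ?_
    rw [mul_assoc]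
    refine le_mul_of_one_le_right hp0.le ?_
    rwa [inv_le_iff_one_le_mul₀' ha] at hs
  rcases le_total a⁻¹ t with h | h
  · refine (key t h).trans ?_
    rw [div_le_iff₀ hp0]
    field_simp
    linarith
  · have h1 : phiTail a t = (∫ u in t..a⁻¹, phiFun a u) + phiTail a a⁻¹ := by
      rw [intervalIntegral_phiFun]
      ring
    have h2 : |∫ u in t..a⁻¹, phiFun a u| ≤ 3 * a / (2 * Real.pi) * |a⁻¹ - t| := by
      rw [← Real.norm_eq_abs]
      exact intervalIntegral.norm_integral_le_of_norm_le_const fun u _ => abs_phiFun_le ha u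
    have h3 : 3 * a / (2 * Real.pi) * |a⁻¹ - t| ≤ 3 / (2 * Real.pi) := by
      rw [abs_of_nonneg (by linarith)]
      calc _ ≤ 3 * a / (2 * Real.pi) * a⁻¹ :=
            mul_le_mul_of_nonneg_left (by linarith) (by positivity)
        _ = _ := by field_simp
    rw [h1]
    refine ((abs_add_le _ _).trans (add_le_add (h2.trans h3) (key _ le_rfl))).trans ?_
    have h4 : 1 + 1 / Real.pi - (3 / (2 * Real.pi) + 2 / Real.pi)
        = (Real.pi - 5 / 2) / Real.pi := by
      field_simp
      ring
    have h5 : 0 ≤ (Real.pi - 5 / 2) / Real.pi := div_nonneg (by linarith) hp0.le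
    linarith

theorem abs_sin_sub_half_sin_le (x y : ℝ) : |Real.sin x - Real.sin y / 2| ≤ 3 / 2 := by
  have h1 := abs_le.1 (Real.abs_sin_le_one x)
  have h2 := abs_le.1 (Real.abs_sin_le_one y)
  exact abs_le.2 ⟨by linarith [h1.1, h2.2], by linarith [h1.2, h2.1]⟩

/-- The absolute value bound `O(1/t)` is not integrable, so the oscillation of `φ_a` has to be used.
One integration by parts gains a power of `t`, and this is what puts `ψ_a` in `L¹`. -/
theorem abs_phiTail_le_rpow (ha : 0 < a) {t : ℝ} (ht : 0 < t) :
    |phiTail a t| ≤ 3 / (Real.pi * a ^ 2) * (t ^ 2)⁻¹ := by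
  have hp := Real.pi_pos
  set N : ℝ → ℝ := fun s => Real.sin (a * s) - Real.sin (2 * a * s) / 2 with hN
  -- `N / a` is a primitive of `cos(as) - cos(2as)`, so `G' = φ_a - R`. The boundary term `G t` and
  -- the integral of `R` each contribute half of the constant `3/(πa²)`.
  set G : ℝ → ℝ := fun s => N s / (Real.pi * a ^ 2 * s ^ 2) with hG
  set R : ℝ → ℝ := fun s => 2 * N s / (Real.pi * a ^ 2 * s ^ 3) with hR
  have hNle : ∀ s, |N s| ≤ 3 / 2 := fun s => abs_sin_sub_half_sin_le _ _
  have hGle : ∀ s, |G s| ≤ 3 / 2 / (Real.pi * a ^ 2) * (s ^ 2)⁻¹ := fun s => by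
    rw [hG, abs_div, abs_of_nonneg (by positivity : 0 ≤ Real.pi * a ^ 2 * s ^ 2),
      ← div_eq_mul_inv, div_div]
    exact div_le_div_of_nonneg_right (hNle s) (by positivity)
  have hRle : ∀ s ∈ Set.Ioi t, ‖R s‖ ≤ 3 / (Real.pi * a ^ 2) * s ^ (-3 : ℝ) := fun s hs => by
    have hs0 : 0 < s := ht.trans hs
    rw [hR, Real.norm_eq_abs, abs_div, abs_mul, abs_two,
      abs_of_nonneg (by positivity : 0 ≤ Real.pi * a ^ 2 * s ^ 3),
      Real.rpow_neg hs0.le, ← div_eq_mul_inv, div_div,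
      show (3 : ℝ) = ((3 : ℕ) : ℝ) by norm_num, Real.rpow_natCast]
    exact div_le_div_of_nonneg_right (by push_cast; linarith [hNle s]) (by positivity)
  have hdom : IntegrableOn (fun s : ℝ => 3 / (Real.pi * a ^ 2) * s ^ (-3 : ℝ)) (Set.Ioi t) :=
    (integrableOn_Ioi_rpow_of_lt (by norm_num : (-3 : ℝ) < -1) ht).const_mul _
  have hRint : IntegrableOn R (Set.Ioi t) := by
    refine hdom.mono' ?_ ((ae_restrict_iff' measurableSet_Ioi).2 (ae_of_all _ hRle))
    have : Measurable R := by
      simp only [hR, hN]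
      fun_prop
    exact this.aestronglyMeasurable
  have hder : ∀ s, 0 < s → HasDerivAt G (phiFun a s - R s) s := fun s hs => by
    have h1 := ((hasDerivAt_id s).const_mul a).sin
    have h2 := (((hasDerivAt_id s).const_mul (2 * a)).sin).div_const 2
    have h3 := ((hasDerivAt_id s).pow 2).const_mul (Real.pi * a ^ 2)
    refine ((h1.sub h2).div h3 (by change Real.pi * a ^ 2 * s ^ 2 ≠ 0; positivity)).congr_deriv ?_
    simp only [id, phiFun_eq_cos_sub_cos, hR, hN]
    simp
    field_simp
  have hlim : Tendsto G atTop (𝓝 0) := by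
    refine squeeze_zero_norm (fun s => hGle s) ?_
    have h := ((tendsto_pow_atTop (α := ℝ) two_ne_zero).inv_tendsto_atTop).const_mul
      (3 / 2 / (Real.pi * a ^ 2))
    rw [mul_zero] at h
    exact h
  have h1 := integral_Ioi_of_hasDerivAt_of_tendsto (a := t) (f := G)
    (f' := fun s => phiFun a s - R s) (hder t ht).continuousAt.continuousWithinAt
    (fun s hs => hder s (ht.trans hs)) ((integrable_phiFun a).integrableOn.sub hRint) hlim
  rw [integral_sub (integrable_phiFun a).integrableOn hRint] at h1
  have h2 : phiTail a t = (∫ s in Set.Ioi t, R s) - G t := by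
    rw [phiTail]
    linarith
  have h3 := norm_integral_le_of_norm_le hdom
    ((ae_restrict_iff' measurableSet_Ioi).2 (ae_of_all _ hRle))
  rw [integral_const_mul, integral_Ioi_rpow_of_lt (by norm_num) ht] at h3
  have h4 : t ^ ((-3 : ℝ) + 1) = (t ^ 2)⁻¹ := by
    rw [show (-3 : ℝ) + 1 = -((2 : ℕ) : ℝ) by norm_num, Real.rpow_neg ht.le, Real.rpow_natCast]
  rw [h4, Real.norm_eq_abs] at h3
  rw [h2]
  refine (abs_sub _ _).trans ((add_le_add h3 (hGle t)).trans_eq ?_)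
  ring

/-- The function `-i ψ_a`. -/
noncomputable def psiFun (a t : ℝ) : ℝ := if 0 < t then phiTail a t else phiTail a t - 1

theorem psiFun_of_pos {t : ℝ} (ht : 0 < t) : psiFun a t = phiTail a t := if_pos ht

theorem psiFun_of_nonpos {t : ℝ} (ht : t ≤ 0) : psiFun a t = phiTail a t - 1 :=
  if_neg (not_lt.2 ht)

/-- Subtracting the total mass `1` on the left half-line turns the tail into the reflected tail up
to sign, so all bounds reduce to `t ≥ 0`. -/
theorem abs_psiFun (ha : 0 < a) (t : ℝ) : |psiFun a t| = |phiTail a (|t|)| := by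
  rcases lt_or_ge 0 t with h | h
  · rw [psiFun_of_pos h, abs_of_pos h]
  · rw [psiFun_of_nonpos h, abs_of_nonpos h, phiTail_neg ha, abs_sub_comm]

theorem abs_psiFun_le (ha : 0 < a) (t : ℝ) : |psiFun a t| ≤ 1 + 1 / Real.pi := by
  rw [abs_psiFun ha]
  exact abs_phiTail_le ha (abs_nonneg t)

theorem measurable_psiFun (a : ℝ) : Measurable (psiFun a) :=
  Measurable.ite measurableSet_Ioi (continuous_phiTail a).measurable
    ((continuous_phiTail a).measurable.sub_const 1)

theorem integrable_psiFun (ha : 0 < a) : Integrable (psiFun a) := by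
  have hp := Real.pi_pos
  refine (integrable_inv_one_add_sq.const_mul
    ((1 + 1 / Real.pi) + 3 / (Real.pi * a ^ 2))).mono' (measurable_psiFun a).aestronglyMeasurable
    (ae_of_all _ fun t => ?_)
  rw [Real.norm_eq_abs, ← div_eq_mul_inv, le_div_iff₀ (by positivity)]
  have h1 := abs_psiFun_le ha t
  have h2 : |psiFun a t| * t ^ 2 ≤ 3 / (Real.pi * a ^ 2) := by
    rcases eq_or_ne t 0 with rfl | ht
    · simp
      positivity
    · have h := abs_phiTail_le_rpow ha (abs_pos.2 ht)
      rw [abs_psiFun ha, ← le_div_iff₀ (by positivity)]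
      rwa [sq_abs, ← div_eq_mul_inv] at h
  rw [mul_add, mul_one]
  exact add_le_add h1 h2

theorem psiFun_neg (ha : 0 < a) {t : ℝ} (ht : t ≠ 0) : psiFun a (-t) = -psiFun a t := by
  rcases lt_or_gt_of_ne ht with h | h
  · rw [psiFun_of_nonpos h.le, psiFun_of_pos (by linarith), phiTail_neg ha]
    ring
  · rw [psiFun_of_pos h, psiFun_of_nonpos (by linarith), phiTail_neg ha]
    ring

theorem integral_psiFun (ha : 0 < a) : ∫ t, psiFun a t = 0 := by
  have h : ∫ t, psiFun a t = -∫ t, psiFun a t := by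
    rw [← integral_neg]
    nth_rewrite 1 [← integral_neg_eq_self]
    refine integral_congr_ae ?_
    filter_upwards [Measure.ae_ne volume (0 : ℝ)] with t ht using psiFun_neg ha ht
  linarith

theorem tendsto_phiTail_atTop (a : ℝ) : Tendsto (phiTail a) atTop (𝓝 0) := by
  have h : Tendsto (fun t => phiTail a 0 - ∫ u in (0 : ℝ)..t, phiFun a u) atTop
      (𝓝 (phiTail a 0 - phiTail a 0)) :=
    (intervalIntegral_tendsto_integral_Ioi 0 (integrable_phiFun a).integrableOn
      tendsto_id).const_sub _
  rw [sub_self] at h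
  rwa [funext (phiTail_eq a)]

theorem tendsto_phiTail_atBot (ha : 0 < a) : Tendsto (phiTail a) atBot (𝓝 1) := by
  have h : Tendsto (fun t => 1 - phiTail a (-t)) atBot (𝓝 (1 - 0)) :=
    ((tendsto_phiTail_atTop a).comp tendsto_neg_atBot_atTop).const_sub 1
  rw [sub_zero] at h
  refine h.congr fun t => ?_
  rw [phiTail_neg ha]
  ring

/-! ### The Fourier transform of `ψ_a` -/

theorem hasDerivAt_cexp_div {ξ : ℝ} (hξ : ξ ≠ 0) (t : ℝ) :
    HasDerivAt (fun t : ℝ => Complex.exp (-(Complex.I * t * ξ)) / (-(Complex.I * ξ)))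
      (Complex.exp (-(Complex.I * t * ξ))) t := by
  have hξ' : (ξ : ℂ) ≠ 0 := by exact_mod_cast hξ
  have h1 : HasDerivAt (fun t : ℝ => -(Complex.I * (t : ℂ) * ξ)) (-(Complex.I * 1 * ξ)) t :=
    (((Complex.ofRealCLM.hasDerivAt (x := t)).const_mul Complex.I).mul_const (ξ : ℂ)).neg
  refine (h1.cexp.div_const _).congr_deriv ?_
  have := Complex.I_ne_zero
  field_simp

theorem norm_cexp_neg_I_mul (t ξ : ℝ) : ‖Complex.exp (-(Complex.I * t * ξ))‖ = 1 := by
  rw [show -(Complex.I * (t : ℂ) * ξ) = ((-(t * ξ) : ℝ) : ℂ) * Complex.I by push_cast; ring]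
  exact Complex.norm_exp_ofReal_mul_I _

theorem integrable_mul_cexp {g : ℝ → ℂ} (hg : Integrable g) (ξ : ℝ) :
    Integrable fun t : ℝ => g t * Complex.exp (-(Complex.I * t * ξ)) :=
  hg.mul_bdd (c := 1) (Continuous.aestronglyMeasurable (by fun_prop))
    (ae_of_all _ fun t => (norm_cexp_neg_I_mul t ξ).le)

/-- Integrate by parts on each half-line. The boundary terms at `0` differ by the unit jump of
`psiFun` and leave `1/(iξ)`, while the integrals of `φ_a` combine to `τ_a(ξ)/(iξ)`. At `ξ = 0` the
integral vanishes because `psiFun` is odd almost everywhere. -/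
theorem integral_psiFun_mul_cexp (ha : 0 < a) (ξ : ℝ) :
    ∫ t : ℝ, (psiFun a t : ℂ) * Complex.exp (-(Complex.I * t * ξ)) = -Complex.I * omega a ξ := by
  rcases eq_or_ne ξ 0 with rfl | hξ
  · rw [omega_of_abs_le (by simpa using ha.le)]
    simp [integral_complex_ofReal, integral_psiFun ha]
  have hξ' : (ξ : ℂ) ≠ 0 := by exact_mod_cast hξ
  set e : ℝ → ℂ := fun t => Complex.exp (-(Complex.I * t * ξ)) with he
  set E : ℝ → ℂ := fun t => e t / (-(Complex.I * ξ)) with hE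
  have hEd : ∀ t, HasDerivAt E (e t) t := hasDerivAt_cexp_div hξ
  have hEc : Continuous E := continuous_iff_continuousAt.2 fun t => (hEd t).continuousAt
  have hEb : ∀ t, ‖E t‖ ≤ 1 / |ξ| := fun t => by
    rw [hE, norm_div, norm_cexp_neg_I_mul, norm_neg, norm_mul, Complex.norm_I, one_mul,
      Complex.norm_real, Real.norm_eq_abs]
  have hint := integrable_mul_cexp (integrable_psiFun ha).ofReal ξ
  have hintφ : Integrable fun t => (phiFun a t : ℂ) * E t :=
    (integrable_phiFun a).ofReal.mul_bdd (c := 1 / |ξ|) hEc.aestronglyMeasurable (ae_of_all _ hEb)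
  have hbdd : ∀ {l : Filter ℝ} {g : ℝ → ℂ}, Tendsto g l (𝓝 0) →
      Tendsto (fun t => g t * E t) l (𝓝 0) := fun {l g} hg => by
    refine squeeze_zero_norm (a := fun t => ‖g t‖ * (1 / |ξ|)) (fun t => ?_) ?_
    · rw [norm_mul]
      exact mul_le_mul_of_nonneg_left (hEb t) (norm_nonneg _)
    · simpa using hg.norm.mul_const (1 / |ξ|)
  have hd : ∀ t : ℝ, t ≠ 0 → HasDerivAt (fun s => (phiTail a s : ℂ)) (-(phiFun a t : ℂ)) t :=
    fun t ht => by simpa using (hasDerivAt_phiTail ha ht).ofReal_comp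
  have hcT : Continuous fun t => (phiTail a t : ℂ) :=
    Complex.continuous_ofReal.comp (continuous_phiTail a)
  have hcomp : ∫ t : ℝ, (psiFun a t : ℂ) * e t = (∫ t in Set.Iic (0 : ℝ), (psiFun a t : ℂ) * e t)
      + ∫ t in Set.Ioi (0 : ℝ), (psiFun a t : ℂ) * e t :=
    (intervalIntegral.integral_Iic_add_Ioi hint.integrableOn hint.integrableOn).symm
  have hpos : ∫ t in Set.Ioi (0 : ℝ), (psiFun a t : ℂ) * e t
      = 0 - phiTail a 0 * E 0 - ∫ t in Set.Ioi (0 : ℝ), -(phiFun a t : ℂ) * E t := by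
    have hcongr : Set.EqOn (fun t => (psiFun a t : ℂ) * e t) (fun t => (phiTail a t : ℂ) * e t)
        (Set.Ioi 0) := fun t ht => by simp only [psiFun_of_pos (Set.mem_Ioi.1 ht)]
    rw [setIntegral_congr_fun measurableSet_Ioi hcongr]
    refine integral_Ioi_mul_deriv_eq_deriv_mul (fun t ht => hd t (ne_of_gt ht))
      (fun t _ => hEd t) (hint.integrableOn.congr_fun hcongr measurableSet_Ioi) ?_ ?_ ?_
    · simpa [Pi.mul_def] using hintφ.neg.integrableOn
    · exact ((hcT.mul hEc).tendsto 0).mono_left nhdsWithin_le_nhds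
    · refine hbdd ?_
      have h1 := (Complex.continuous_ofReal.tendsto 0).comp (tendsto_phiTail_atTop a)
      rw [Complex.ofReal_zero] at h1
      exact h1
  have hneg : ∫ t in Set.Iic (0 : ℝ), (psiFun a t : ℂ) * e t
      = (phiTail a 0 - 1) * E 0 - 0 - ∫ t in Set.Iic (0 : ℝ), -(phiFun a t : ℂ) * E t := by
    have hcongr : Set.EqOn (fun t => (psiFun a t : ℂ) * e t)
        (fun t => ((phiTail a t : ℂ) - 1) * e t) (Set.Iic 0) := fun t ht => by
      simp only [psiFun_of_nonpos (Set.mem_Iic.1 ht)]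
      push_cast
      rfl
    rw [setIntegral_congr_fun measurableSet_Iic hcongr]
    refine integral_Iic_mul_deriv_eq_deriv_mul
      (fun t ht => (hd t (ne_of_lt ht)).sub_const 1)
      (fun t _ => hEd t) (hint.integrableOn.congr_fun hcongr measurableSet_Iic) ?_ ?_ ?_
    · simpa [Pi.mul_def] using hintφ.neg.integrableOn
    · exact (((hcT.sub continuous_const).mul hEc).tendsto 0).mono_left nhdsWithin_le_nhds
    · refine hbdd ?_
      have h1 := ((Complex.continuous_ofReal.tendsto 1).comp (tendsto_phiTail_atBot ha)).sub_const 1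
      simpa using h1
  have hsum : (∫ t in Set.Iic (0 : ℝ), -(phiFun a t : ℂ) * E t)
      + ∫ t in Set.Ioi (0 : ℝ), -(phiFun a t : ℂ) * E t = -(tau a ξ / (-(Complex.I * ξ))) := by
    have h1 : Integrable fun t => -(phiFun a t : ℂ) * E t := by simpa using hintφ.neg
    rw [intervalIntegral.integral_Iic_add_Ioi h1.integrableOn h1.integrableOn,
      ← fourierL1_phi ha ξ, fourierL1, ← integral_div, ← integral_neg]
    refine integral_congr_ae ?_
    filter_upwards [phi_ae a] with t ht
    rw [ht]
    simp only [hE, he]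
    ring
  have hE0 : E 0 = 1 / (-(Complex.I * ξ)) := by simp [hE, he]
  rw [hcomp, hpos, hneg]
  have hfin : ((phiTail a 0 : ℂ) - 1) * E 0 - 0 - (∫ t in Set.Iic (0 : ℝ), -(phiFun a t : ℂ) * E t)
      + (0 - phiTail a 0 * E 0 - ∫ t in Set.Ioi (0 : ℝ), -(phiFun a t : ℂ) * E t)
      = -E 0 - ((∫ t in Set.Iic (0 : ℝ), -(phiFun a t : ℂ) * E t)
      + ∫ t in Set.Ioi (0 : ℝ), -(phiFun a t : ℂ) * E t) := by ring
  rw [hfin, hsum, hE0, omega]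
  push_cast
  have := Complex.I_ne_zero
  field_simp
  rw [Complex.I_sq]
  ring

/-- The function `ψ_a` as an element of `L¹(ℝ)`. -/
noncomputable def psi (ha : 0 < a) : L1 :=
  (memLp_one_iff_integrable.2 ((integrable_psiFun ha).ofReal.const_mul Complex.I)).toLp
    fun t => Complex.I * psiFun a t

theorem psi_ae (ha : 0 < a) : psi ha =ᵐ[volume] fun t => Complex.I * psiFun a t :=
  MemLp.coeFn_toLp _

theorem fourierL1_psi (ha : 0 < a) (ξ : ℝ) : fourierL1 (psi ha) ξ = omega a ξ := by
  have h : fourierL1 (psi ha) ξ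
      = ∫ t : ℝ, Complex.I * ((psiFun a t : ℂ) * Complex.exp (-(Complex.I * t * ξ))) := by
    refine integral_congr_ae ?_
    filter_upwards [psi_ae ha] with t ht
    rw [ht, mul_assoc]
  rw [h, integral_const_mul, integral_psiFun_mul_cexp ha, ← mul_assoc, mul_neg, Complex.I_mul_I,
    neg_neg, one_mul]

/-- By injectivity of the Fourier transform, the bounds and the jump structure of `psiFun` are
available for any `ψ` with transform `ω_a`. -/
theorem ae_eq_of_fourierL1_eq_omega (ha : 0 < a) {ψ : L1} (h : ∀ ξ, fourierL1 ψ ξ = omega a ξ) :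
    ψ =ᵐ[volume] fun t => Complex.I * psiFun a t := by
  rw [fourierL1_injective fun ξ => (h ξ).trans (fourierL1_psi ha ξ).symm]
  exact psi_ae ha

end Psi

/-! ### Primitives and products of locally absolutely continuous functions -/

theorem LocAC.ofReal {u : ℝ → ℝ} (hu : ∀ a b : ℝ, AbsolutelyContinuousOnInterval u a b) :
    LocAC fun x => (u x : ℂ) := by
  intro a b
  have h := hu a b
  rw [absolutelyContinuousOnInterval_iff] at h ⊢
  simpa only [Complex.isometry_ofReal.dist_eq] using h

theorem LocAC.const (c : ℂ) : LocAC fun _ => c := fun _ _ =>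
  LipschitzOnWith.absolutelyContinuousOnInterval (LipschitzWith.const c).lipschitzOnWith

theorem LocAC.mul {f g : ℝ → ℂ} (hf : LocAC f) (hg : LocAC g) : LocAC (fun x => f x * g x) :=
  fun a b => (hf a b).smul (hg a b)

theorem LocAC.of_contDiff {f : ℝ → ℂ} (hf : ContDiff ℝ 1 f) : LocAC f := fun _ _ =>
  hf.contDiffOn.absolutelyContinuousOnInterval

theorem intervalIntegrable_of_locallyIntegrable {g : ℝ → ℂ} (hg : LocallyIntegrable g) (a b : ℝ) :
    IntervalIntegrable g volume a b :=
  (hg.integrableOn_isCompact isCompact_uIcc).intervalIntegrable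

theorem LocAC.primitive {g : ℝ → ℂ} (hg : LocallyIntegrable g) (c : ℝ) :
    LocAC fun s => ∫ u in c..s, g u := by
  have hi := intervalIntegrable_of_locallyIntegrable hg
  have key : ∀ L : ℂ →L[ℝ] ℝ, ∀ a b : ℝ,
      AbsolutelyContinuousOnInterval (fun s => ∫ u in c..s, L (g u)) a b := fun L a b => by
    have hL : ∀ a b, IntervalIntegrable (fun u => L (g u)) volume a b := fun a b =>
      ⟨L.integrable_comp (hi a b).1, L.integrable_comp (hi a b).2⟩
    -- The interval is enlarged so as to contain the base point `c`. `h` serves for `a ≤ b` and `h'`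
    -- for `b ≤ a`.
    have h := (hL (min a c) (max b c)).absolutelyContinuousOnInterval_intervalIntegral
      (c := c) (Set.mem_uIcc_of_le (min_le_right _ _) (le_max_right _ _))
    have h' := (hL (min b c) (max a c)).absolutelyContinuousOnInterval_intervalIntegral
      (c := c) (Set.mem_uIcc_of_le (min_le_right _ _) (le_max_right _ _))
    rcases le_total a b with hab | hab
    · refine h.mono ?_
      rw [Set.uIcc_of_le hab, Set.uIcc_of_le ((min_le_right _ _).trans (le_max_right _ _))]
      exact Set.Icc_subset_Icc (min_le_left _ _) (le_max_left _ _)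
    · refine h'.mono ?_
      rw [Set.uIcc_of_ge hab, Set.uIcc_of_le ((min_le_right _ _).trans (le_max_right _ _))]
      exact Set.Icc_subset_Icc (min_le_left _ _) (le_max_left _ _)
  have h3 : (fun s => ∫ u in c..s, g u)
      = (fun s => ((∫ u in c..s, Complex.reCLM (g u) : ℝ) : ℂ))
        + Complex.I • fun s => ((∫ u in c..s, Complex.imCLM (g u) : ℝ) : ℂ) := by
    funext s
    rw [Pi.add_apply, Pi.smul_apply, Complex.reCLM.intervalIntegral_comp_comm (hi c s),
      Complex.imCLM.intervalIntegral_comp_comm (hi c s)]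
    simp [mul_comm Complex.I]
  rw [h3]
  exact (LocAC.ofReal (key Complex.reCLM)).add ((LocAC.ofReal (key Complex.imCLM)).smul Complex.I)

theorem ae_hasDerivAt_primitive {g : ℝ → ℂ} (hg : LocallyIntegrable g) (c : ℝ) :
    ∀ᵐ s, HasDerivAt (fun s => ∫ u in c..s, g u) (g s) s := by
  filter_upwards [LocallyIntegrable.ae_hasDerivAt_integral hg] with s hs using hs c

theorem locallyIntegrable_L2 (x : L2) : LocallyIntegrable x :=
  (Lp.memLp x).locallyIntegrable (by norm_num)

/-- A function whose increments are the integrals of a square integrable function represents an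
element of the Sobolev space. -/
theorem IsRep.of_primitive {y g : L2} {Y : ℝ → ℂ} (hy : y =ᵐ[volume] Y)
    (hY : ∀ s, Y s = Y 0 + ∫ u in (0 : ℝ)..s, g u) : IsRep y Y := by
  have hlg := locallyIntegrable_L2 g
  have hY' : Y = (fun _ => Y 0) + fun s => ∫ u in (0 : ℝ)..s, g u := funext hY
  refine ⟨?_, hy, ?_⟩
  · rw [hY']
    exact (LocAC.const _).add (LocAC.primitive hlg 0)
  · refine (Lp.memLp g).ae_eq ?_
    filter_upwards [ae_hasDerivAt_primitive hlg 0] with s hs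
    rw [hY', ((hasDerivAt_const s (Y 0)).add hs).deriv, zero_add]

/-! ### Twisted convolutions -/

section TwistedConvolution

theorem quasiMeasurePreserving_sub_two_mul (s : ℝ) :
    Measure.QuasiMeasurePreserving (fun r : ℝ => s - 2 * r) volume volume := by
  have h1 : Measure.QuasiMeasurePreserving (fun r : ℝ => 2 * r) volume volume := by
    refine ⟨by fun_prop, ?_⟩
    rw [Real.map_volume_mul_left two_ne_zero]
    exact Measure.smul_absolutelyContinuous
  exact (Measure.measurePreserving_sub_left volume s).quasiMeasurePreserving.comp h1

/-- The substitution `t = s - r` frees `v` from the variable `s`, in which the integral will be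
differentiated; `v` is merely square integrable. It also allows passing to everywhere defined
representatives `p` and `q`. -/
theorem integral_action_eq_twisted {h : ℝ → ℂ} {p q z : ℝ → ℂ} (v : ℝ → ℂ)
    (hp : h =ᵐ[volume] p) (hq : z =ᵐ[volume] q) (s : ℝ) :
    ∫ t, h t * (v (s - t) * z (2 * t - s)) = ∫ r, p (s - r) * (v r * q (s - 2 * r)) := by
  rw [← integral_sub_left_eq_self _ volume s]
  refine integral_congr_ae ?_
  filter_upwards [
    (Measure.measurePreserving_sub_left volume s).quasiMeasurePreserving.ae_eq_comp hp,
    (quasiMeasurePreserving_sub_two_mul s).ae_eq_comp hq] with r h1 h2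
  simp only [Function.comp_apply] at h1 h2
  rw [show s - (s - r) = r by ring, show 2 * (s - r) - s = s - 2 * r by ring, h1, h2]

variable {p q : ℝ → ℂ} {M : ℝ} {v : L2}

theorem norm_twisted_le (hM : ∀ t, ‖p t‖ ≤ M) (s r : ℝ) :
    ‖p (s - r) * (v r * q (s - 2 * r))‖ ≤ M * (‖v r‖ ^ 2 + ‖q (s - 2 * r)‖ ^ 2) := by
  rw [norm_mul, norm_mul]
  refine mul_le_mul (hM _) ?_ (by positivity) ((norm_nonneg _).trans (hM 0))
  nlinarith [sq_nonneg (‖v r‖ - ‖q (s - 2 * r)‖), sq_nonneg ‖v r‖, sq_nonneg ‖q (s - 2 * r)‖]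

theorem integrable_norm_sq {q : ℝ → ℂ} (hq : MemLp q 2) : Integrable fun t => ‖q t‖ ^ 2 := by
  simpa using hq.integrable_norm_pow (by norm_num)

theorem integrable_comp_sub_two_mul {g : ℝ → ℝ} (hg : Integrable g) (s : ℝ) :
    Integrable fun r => g (s - 2 * r) :=
  (hg.comp_sub_left s).comp_mul_left' two_ne_zero

theorem integral_comp_sub_two_mul (g : ℝ → ℝ) (s : ℝ) :
    ∫ r, g (s - 2 * r) = 1 / 2 * ∫ t, g t := by
  rw [Measure.integral_comp_mul_left (fun t => g (s - t)), integral_sub_left_eq_self]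
  simp

theorem measurable_twisted (hp : Measurable p) (hq : Measurable q) :
    Measurable fun z : ℝ × ℝ => p (z.1 - z.2) * (v z.2 * q (z.1 - 2 * z.2)) :=
  (hp.comp (measurable_fst.sub measurable_snd)).mul
    (((Lp.stronglyMeasurable v).measurable.comp measurable_snd).mul
      (hq.comp (measurable_fst.sub (measurable_snd.const_mul 2))))

theorem integrable_twisted (hp : Measurable p) (hM : ∀ t, ‖p t‖ ≤ M) (hqm : Measurable q)
    (hq : MemLp q 2) (s : ℝ) : Integrable fun r => p (s - r) * (v r * q (s - 2 * r)) :=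
  (((integrable_norm_sq (Lp.memLp v)).add
    (integrable_comp_sub_two_mul (integrable_norm_sq hq) s)).const_mul M).mono'
    ((measurable_twisted hp hqm).comp measurable_prodMk_left).aestronglyMeasurable
    (ae_of_all _ fun r => norm_twisted_le hM s r)

/-- The integral over `r` of the norm is at most `M (‖v‖² + ½ ‖q‖²)`, uniformly in `s`, hence
integrable for a finite measure in `s`. This justifies Fubini for the increments of `𝒯(ψ_a)Vx`. -/
theorem integrable_prod_twisted (hp : Measurable p) (hM : ∀ t, ‖p t‖ ≤ M) (hqm : Measurable q)
    (hq : MemLp q 2) (μ : Measure ℝ) [IsFiniteMeasure μ] :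
    Integrable (Function.uncurry fun s r => p (s - r) * (v r * q (s - 2 * r)))
      (μ.prod volume) := by
  have hm := measurable_twisted (v := v) hp hqm
  refine (integrable_prod_iff hm.aestronglyMeasurable).2 ?_
  refine ⟨ae_of_all _ fun s => integrable_twisted hp hM hqm hq s, ?_⟩
  refine (integrable_const (M * ((∫ r, ‖v r‖ ^ 2) + 1 / 2 * ∫ r, ‖q r‖ ^ 2))).mono'
    hm.stronglyMeasurable.norm.integral_prod_right'.aestronglyMeasurable (ae_of_all _ fun s => ?_)
  have h1 := integrable_norm_sq (Lp.memLp v)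
  have h2 := integrable_comp_sub_two_mul (integrable_norm_sq hq) s
  rw [Real.norm_of_nonneg (integral_nonneg fun _ => norm_nonneg _),
    ← integral_comp_sub_two_mul (fun t => ‖q t‖ ^ 2) s, ← integral_add h1 h2, ← integral_const_mul]
  exact integral_mono (integrable_twisted hp hM hqm hq s).norm ((h1.add h2).const_mul M)
    fun r => norm_twisted_le hM s r

end TwistedConvolution

/-! ### `𝒯(ψ_a)V` leaves the Sobolev space invariant -/

section Invariance

variable {a : ℝ}

theorem locAC_phiTail (a : ℝ) : LocAC fun t => (phiTail a t : ℂ) := by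
  have h : (fun t => (phiTail a t : ℂ))
      = (fun _ => (phiTail a 0 : ℂ)) + (-1 : ℂ) • fun t => ∫ u in (0 : ℝ)..t, (phiFun a u : ℂ) := by
    funext t
    rw [Pi.add_apply, Pi.smul_apply, intervalIntegral.integral_ofReal, phiTail_eq]
    simp [sub_eq_add_neg]
  rw [h]
  exact (LocAC.const _).add
    ((LocAC.primitive (integrable_phiFun a).ofReal.locallyIntegrable 0).smul _)

theorem norm_phiTail_le (ha : 0 < a) (t : ℝ) : ‖(phiTail a t : ℂ)‖ ≤ 2 + 1 / Real.pi := by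
  rw [Complex.norm_real, Real.norm_eq_abs]
  have h := abs_psiFun_le ha t
  rcases lt_or_ge 0 t with ht | ht
  · rw [psiFun_of_pos ht] at h
    linarith
  · rw [psiFun_of_nonpos ht] at h
    have := abs_sub_abs_le_abs_sub (phiTail a t) 1
    rw [abs_one] at this
    linarith

theorem memLp_shift {f : ℝ → ℂ} (hf : MemLp f 2) (t : ℝ) : MemLp (fun s => f (s + t)) 2 :=
  hf.comp_measurePreserving (measurePreserving_add_right volume t)

theorem phiTail_mul_sub (ha : 0 < a) {f : ℝ → ℂ} (hf : LocAC f) (hf2 : MemLp f 2)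
    (hf' : MemLp (deriv f) 2) (r t s₁ s₂ : ℝ) :
    phiTail a (s₂ + r) * f (s₂ + t) - phiTail a (s₁ + r) * f (s₁ + t)
      = ∫ s in s₁..s₂, ((phiTail a (s + r) : ℂ) * deriv f (s + t)
          - phiFun a (s + r) * f (s + t)) := by
  have hT := (locAC_phiTail a).comp_add r
  have hP := hf.comp_add t
  have hd : deriv (fun s => (phiTail a (s + r) : ℂ) * f (s + t)) =ᵐ[volume]
      fun s => (phiTail a (s + r) : ℂ) * deriv f (s + t) - phiFun a (s + r) * f (s + t) := by
    filter_upwards [Measure.ae_ne volume (-r), hP.ae_differentiableAt] with s hs hs'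
    have h1 : HasDerivAt (fun s => (phiTail a (s + r) : ℂ)) (-(phiFun a (s + r) : ℂ)) s := by
      have h0 := (hasDerivAt_phiTail ha (t := s + r) fun h => hs (by linarith)).ofReal_comp
      rw [Complex.ofReal_neg] at h0
      exact h0.comp_add_const s r
    have h2 := hs'.hasDerivAt
    rw [deriv_comp_add_const] at h2
    refine (h1.mul h2).deriv.trans ?_
    ring
  have hL2 : MemLp (fun s => (phiTail a (s + r) : ℂ) * deriv f (s + t)
      - phiFun a (s + r) * f (s + t)) 2 := by
    refine MemLp.sub ?_ ?_
    · refine (memLp_shift hf' t).of_le_mul (c := 2 + 1 / Real.pi)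
        (hT.continuous.aestronglyMeasurable.mul (memLp_shift hf' t).1) (ae_of_all _ fun s => ?_)
      rw [norm_mul]
      exact mul_le_mul_of_nonneg_right (norm_phiTail_le ha _) (norm_nonneg _)
    · refine (memLp_shift hf2 t).of_le_mul (c := 3 * a / (2 * Real.pi)) ?_
        (ae_of_all _ fun s => ?_)
      · exact (((integrable_phiFun a).ofReal.comp_add_right r).aestronglyMeasurable).mul
          (memLp_shift hf2 t).1
      · rw [norm_mul, Complex.norm_real]
        exact mul_le_mul_of_nonneg_right (abs_phiFun_le ha _) (norm_nonneg _)
  rw [← (hT.mul hP).intervalIntegral_deriv (hL2.ae_eq hd.symm)]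
  exact intervalIntegral.integral_congr_ae (hd.mono fun s hs _ => hs)

/-- Separates the locally absolutely continuous part of `psiFun` from its jump, so that the product
rule is needed only for the former. -/
theorem psiFun_eq_sub_ite (a t : ℝ) :
    (psiFun a t : ℂ) = phiTail a t - if t ≤ 0 then 1 else 0 := by
  rcases lt_or_ge 0 t with h | h
  · rw [psiFun_of_pos h, if_neg (not_le.2 h), sub_zero]
  · rw [psiFun_of_nonpos h, if_pos h]
    push_cast
    rfl

/-- The indicator term is the value of `f` lost when the step drops from `1` to `0`. The step still
equals `1` at `s = r`, so the drop lies between `s₁` and `s₂` exactly when `s₁ ≤ r < s₂`; hence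
`Ico`. -/
theorem intervalIntegral_ite_mul_deriv {f : ℝ → ℂ} (hf : LocAC f) (hf' : MemLp (deriv f) 2)
    (r t : ℝ) {s₁ s₂ : ℝ} (h12 : s₁ ≤ s₂) :
    ∫ s in s₁..s₂, (if s ≤ r then 1 else 0) * deriv f (s + t)
      = (if s₂ ≤ r then 1 else 0) * f (s₂ + t) - (if s₁ ≤ r then 1 else 0) * f (s₁ + t)
        + (Set.Ico s₁ s₂).indicator (fun r => f (r + t)) r := by
  have hP := hf.comp_add t
  have hd : deriv (fun s => f (s + t)) = fun s => deriv f (s + t) :=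
    funext fun s => deriv_comp_add_const f t s
  have hP' : MemLp (deriv fun s => f (s + t)) 2 := by
    rw [hd]
    exact memLp_shift hf' t
  have hI := fun x y => hP.intervalIntegral_deriv hP' x y
  have hi := fun x y => intervalIntegrable_of_locallyIntegrable
    (hP'.locallyIntegrable (by norm_num)) x y
  rw [hd] at hI hi
  have hright : ∀ x y : ℝ, x ≤ y → r ≤ x →
      ∫ s in x..y, (if s ≤ r then 1 else 0) * deriv f (s + t) = 0 := fun x y hxy hx => by
    rw [intervalIntegral.integral_of_le hxy]
    refine setIntegral_eq_zero_of_forall_eq_zero fun s hs => ?_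
    rw [if_neg (not_le.2 (hx.trans_lt hs.1)), zero_mul]
  have hleft : ∀ x y : ℝ, x ≤ y → y ≤ r →
      ∫ s in x..y, (if s ≤ r then 1 else 0) * deriv f (s + t) = f (y + t) - f (x + t) :=
    fun x y hxy hy => by
    rw [← hI, intervalIntegral.integral_of_le hxy, intervalIntegral.integral_of_le hxy]
    refine setIntegral_congr_fun measurableSet_Ioc fun s hs => ?_
    simp only [if_pos (hs.2.trans hy), one_mul]
  have hint : ∀ x y : ℝ, IntervalIntegrable
      (fun s => (if s ≤ r then 1 else 0) * deriv f (s + t)) volume x y := fun x y => by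
    have hm : Measurable fun s : ℝ => if s ≤ r then (1 : ℂ) else 0 :=
      Measurable.ite measurableSet_Iic measurable_const measurable_const
    have hb : ∀ s : ℝ, ‖if s ≤ r then (1 : ℂ) else 0‖ ≤ 1 := fun s => by
      split_ifs <;> simp
    exact ⟨(hi x y).1.bdd_mul (c := 1) hm.aestronglyMeasurable (ae_of_all _ hb),
      (hi x y).2.bdd_mul (c := 1) hm.aestronglyMeasurable (ae_of_all _ hb)⟩
  rcases lt_or_ge r s₁ with h1 | h1
  · rw [hright _ _ h12 h1.le, if_neg (not_le.2 (h1.trans_le h12)), if_neg (not_le.2 h1),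
      Set.indicator_of_notMem fun h => (not_le.2 h1) h.1]
    simp
  rcases lt_or_ge r s₂ with h2 | h2
  · rw [← intervalIntegral.integral_add_adjacent_intervals (hint s₁ r) (hint r s₂),
      hleft _ _ h1 le_rfl, hright _ _ h2.le le_rfl, if_neg (not_le.2 h2), if_pos h1,
      Set.indicator_of_mem (show r ∈ Set.Ico s₁ s₂ from ⟨h1, h2⟩)]
    ring
  · rw [hleft _ _ h12 h2, if_pos h1, if_pos h2, Set.indicator_of_notMem fun h => (not_lt.2 h2) h.2]
    ring

/-- The integrated product rule with `psiFun' = δ₀ - φ_a`. The point mass sits at `s = r`, where `f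
(s - 2r)` becomes `f (-r)`. -/
theorem psiFun_mul_sub (ha : 0 < a) {f : ℝ → ℂ} (hf : LocAC f) (hf2 : MemLp f 2)
    (hf' : MemLp (deriv f) 2) (r : ℝ) {s₁ s₂ : ℝ} (h12 : s₁ ≤ s₂) :
    psiFun a (s₂ - r) * f (s₂ - 2 * r) - psiFun a (s₁ - r) * f (s₁ - 2 * r)
      = (∫ s in s₁..s₂, ((psiFun a (s - r) : ℂ) * deriv f (s - 2 * r)
          - phiFun a (s - r) * f (s - 2 * r)))
        + (Set.Ico s₁ s₂).indicator (fun r => f (-r)) r := by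
  have e1 := phiTail_mul_sub ha hf hf2 hf' (-r) (-(2 * r)) s₁ s₂
  have e2 := intervalIntegral_ite_mul_deriv hf hf' r (-(2 * r)) h12
  have e3 : (Set.Ico s₁ s₂).indicator (fun u => f (u + -(2 * r))) r
      = (Set.Ico s₁ s₂).indicator (fun r => f (-r)) r := by
    by_cases h : r ∈ Set.Ico s₁ s₂
    · rw [Set.indicator_of_mem h, Set.indicator_of_mem h]
      congr 1
      ring
    · rw [Set.indicator_of_notMem h, Set.indicator_of_notMem h]
  simp only [← sub_eq_add_neg] at e1 e2 e3
  have hi : ∀ {g : ℝ → ℂ} {M : ℝ}, Measurable g → (∀ s, ‖g s‖ ≤ M) → ∀ {w : ℝ → ℂ}, MemLp w 2 →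
      IntervalIntegrable (fun s => g s * w (s - 2 * r)) volume s₁ s₂ := fun {g M} hg hb {w} hw => by
    have h := intervalIntegrable_of_locallyIntegrable
      ((memLp_shift hw (-(2 * r))).locallyIntegrable (by norm_num)) s₁ s₂
    simp only [← sub_eq_add_neg] at h
    exact ⟨h.1.bdd_mul (c := M) hg.aestronglyMeasurable (ae_of_all _ hb),
      h.2.bdd_mul (c := M) hg.aestronglyMeasurable (ae_of_all _ hb)⟩
  have hcT : Measurable fun s => (phiTail a (s - r) : ℂ) :=
    ((locAC_phiTail a).continuous.comp (continuous_id.sub continuous_const)).measurable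
  have hm : Measurable fun s : ℝ => if s ≤ r then (1 : ℂ) else 0 :=
    Measurable.ite measurableSet_Iic measurable_const measurable_const
  have hb : ∀ s : ℝ, ‖if s ≤ r then (1 : ℂ) else 0‖ ≤ 1 := fun s => by
    split_ifs <;> simp
  have hφm : Measurable fun s => (phiFun a (s - r) : ℂ) := by
    unfold phiFun
    fun_prop
  have hφb : ∀ s, ‖(phiFun a (s - r) : ℂ)‖ ≤ 3 * a / (2 * Real.pi) := fun s => by
    rw [Complex.norm_real]
    exact abs_phiFun_le ha _
  have h1 := hi hcT (fun s => norm_phiTail_le ha (s - r)) hf'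
  have h2 := hi hm hb hf'
  have h3 := hi hφm hφb hf2
  have e4 : ∫ s in s₁..s₂, ((psiFun a (s - r) : ℂ) * deriv f (s - 2 * r)
          - phiFun a (s - r) * f (s - 2 * r))
      = (∫ s in s₁..s₂, ((phiTail a (s - r) : ℂ) * deriv f (s - 2 * r)
          - phiFun a (s - r) * f (s - 2 * r)))
        - ∫ s in s₁..s₂, (if s ≤ r then 1 else 0) * deriv f (s - 2 * r) := by
    rw [← intervalIntegral.integral_sub (h1.sub h3) h2]
    refine intervalIntegral.integral_congr fun s _ => ?_
    simp only [psiFun_eq_sub_ite, sub_nonpos]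
    ring
  rw [e4, e2, ← e1, e3, psiFun_eq_sub_ite, psiFun_eq_sub_ite]
  simp only [sub_nonpos]
  ring

theorem lintegral_phi_sq (ha : 0 < a) :
    ∫⁻ t, ‖phi a t‖ₑ ^ 2 = ENNReal.ofReal (8 * a / 3 / (2 * Real.pi)) :=
  lintegral_fourierL1_sq _ (fourierL1_phi ha) (lintegral_tau_sq ha)

theorem lintegral_psi_sq (ha : 0 < a) {ψ : L1} (h : ∀ ξ, fourierL1 ψ ξ = omega a ξ) :
    ∫⁻ t, ‖ψ t‖ₑ ^ 2 = ENNReal.ofReal ((4 - 4 * Real.log 2) / a / (2 * Real.pi)) :=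
  lintegral_fourierL1_sq _ h (lintegral_omega_sq ha)

theorem action_psi_mem_W12 (ha : 0 < a) {ψ : L1} (h : ∀ ξ, fourierL1 ψ ξ = omega a ξ) (v : L2)
    (x : opA.domain) : (action ψ (opV v)).1 x ∈ W12 := by
  have hx := rep_spec x
  set f := rep x with hf
  have hf2 : MemLp f 2 := (memLp_congr_ae hx.ae_eq).1 (Lp.memLp (x : L2))
  have hfm : Measurable f := hx.locAC.continuous.measurable
  have hf'm : Measurable (deriv f) := measurable_deriv f
  have hf' := hx.memLp_deriv
  obtain ⟨Bψ, -, hBψ, -⟩ := exists_action_opV ψ v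
    ((lintegral_psi_sq ha h).trans_lt ENNReal.ofReal_lt_top)
  obtain ⟨Bφ, -, hBφ, -⟩ := exists_action_opV (phi a) v
    ((lintegral_phi_sq ha).trans_lt ENNReal.ofReal_lt_top)
  set p : ℝ → ℂ := fun t => Complex.I * psiFun a t with hp
  set q : ℝ → ℂ := fun t => Complex.I * phiFun a t with hq
  have hψp : ψ =ᵐ[volume] p := ae_eq_of_fourierL1_eq_omega ha h
  have hpm : Measurable p := (Complex.measurable_ofReal.comp (measurable_psiFun a)).const_mul _
  have hqm : Measurable q := by
    have hm : Measurable (phiFun a) := by unfold phiFun; fun_prop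
    exact (Complex.measurable_ofReal.comp hm).const_mul _
  have hpb : ∀ t, ‖p t‖ ≤ 1 + 1 / Real.pi := fun t => by
    rw [hp, norm_mul, Complex.norm_I, one_mul, Complex.norm_real]
    exact abs_psiFun_le ha t
  have hqb : ∀ t, ‖q t‖ ≤ 3 * a / (2 * Real.pi) := fun t => by
    rw [hq, norm_mul, Complex.norm_I, one_mul, Complex.norm_real]
    exact abs_phiFun_le ha t
  set Y : ℝ → ℂ := fun s => ∫ r, p (s - r) * (v r * f (s - 2 * r)) with hY
  set K : ℝ → ℝ → ℂ := fun s r => p (s - r) * (v r * deriv f (s - 2 * r))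
    - q (s - r) * (v r * f (s - 2 * r)) with hK
  set J : ℝ → ℂ := fun r => Complex.I * (v r * f (-r)) with hJ
  -- The candidate for the derivative, from `ψ_a' = i(δ₀ - φ_a)`: it is `𝒯(ψ_a)V x' - i 𝒯(φ_a)V x +
  -- i Vx`, where `Bψ` and `Bφ` are the bounded extensions. The extension is needed because `x'` may
  -- lie outside `W^{1,2}`.
  set G : L2 := Bψ (derivL2 x) - Complex.I • Bφ x + Complex.I • (opV v).1 x with hG
  have hy : (action ψ (opV v)).1 x =ᵐ[volume] Y :=
    (action_opV_ae ψ v x).trans (ae_of_all _ fun s => integral_action_eq_twisted v hψp hx.ae_eq s)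
  have hGae : G =ᵐ[volume] fun s => (∫ r, K s r) + J s := by
    filter_upwards [Lp.coeFn_add (Bψ (derivL2 x) - Complex.I • Bφ x) (Complex.I • (opV v).1 x),
      Lp.coeFn_sub (Bψ (derivL2 x)) (Complex.I • Bφ x), Lp.coeFn_smul Complex.I (Bφ x),
      Lp.coeFn_smul Complex.I ((opV v).1 x), hBψ (derivL2 x), hBφ x, opV_ae v x,
      (Measure.measurePreserving_neg (volume : Measure ℝ)).quasiMeasurePreserving.ae_eq_comp
        hx.ae_eq] with s e1 e2 e3 e4 e5 e6 e7 e8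
    simp only [Function.comp_apply] at e8
    rw [e1, Pi.add_apply, e2, Pi.sub_apply, e3, e4, Pi.smul_apply, Pi.smul_apply, e5, e6, e7, e8,
      integral_action_eq_twisted v hψp (derivL2_ae hx) s,
      integral_action_eq_twisted v (phi_ae a) hx.ae_eq s, smul_eq_mul, smul_eq_mul,
      ← integral_const_mul, hK, hJ, integral_sub (integrable_twisted hpm hpb hf'm hf' s)
        (integrable_twisted hqm hqb hfm hf2 s)]
    simp only [hq, mul_assoc]
  have hJi : Integrable J :=
    ((Lp.memLp v).integrable_mul (hf2.comp_measurePreserving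
      (Measure.measurePreserving_neg (volume : Measure ℝ)))).const_mul Complex.I
  have hinc : ∀ s₁ s₂ : ℝ, s₁ ≤ s₂ → Y s₂ - Y s₁ = ∫ s in s₁..s₂, G s := fun s₁ s₂ h12 => by
    have hKi : Integrable (Function.uncurry K) ((volume.restrict (Set.Ioc s₁ s₂)).prod volume) :=
      (integrable_prod_twisted hpm hpb hf'm hf' _).sub (integrable_prod_twisted hqm hqb hfm hf2 _)
    -- The increment identity for fixed `r`, multiplied by `i v(r)`. Integrating it over `r` and
    -- exchanging the order of integration gives the increment of `Y` as an integral of `G`.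
    have hpt : ∀ r, p (s₂ - r) * (v r * f (s₂ - 2 * r)) - p (s₁ - r) * (v r * f (s₁ - 2 * r))
        = (∫ s in Set.Ioc s₁ s₂, K s r) + (Set.Ico s₁ s₂).indicator J r := fun r => by
      have e := psiFun_mul_sub ha hx.locAC hf2 hf' r h12
      have e1 : ∫ s in Set.Ioc s₁ s₂, K s r = Complex.I * v r *
          ∫ s in s₁..s₂, ((psiFun a (s - r) : ℂ) * deriv f (s - 2 * r)
          - phiFun a (s - r) * f (s - 2 * r)) := by
        rw [intervalIntegral.integral_of_le h12, ← integral_const_mul]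
        refine integral_congr_ae (ae_of_all _ fun s => ?_)
        simp only [hK, hp, hq]
        ring
      have e2 : (Set.Ico s₁ s₂).indicator J r
          = Complex.I * v r * (Set.Ico s₁ s₂).indicator (fun r => f (-r)) r := by
        by_cases hr : r ∈ Set.Ico s₁ s₂
        · rw [Set.indicator_of_mem hr, Set.indicator_of_mem hr, hJ]
          ring
        · rw [Set.indicator_of_notMem hr, Set.indicator_of_notMem hr, mul_zero]
      rw [e1, e2, ← mul_add, ← e, hp]
      ring
    have hG' : ∫ s in s₁..s₂, G s = ∫ s in Set.Ioc s₁ s₂, ((∫ r, K s r) + J s) := by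
      rw [intervalIntegral.integral_of_le h12]
      exact integral_congr_ae (ae_restrict_of_ae hGae)
    have hL : Integrable (fun s => ∫ r, K s r) (volume.restrict (Set.Ioc s₁ s₂)) :=
      hKi.integral_prod_left
    have hR : Integrable fun r => ∫ s in Set.Ioc s₁ s₂, K s r := hKi.integral_prod_right
    rw [hG', integral_add hL hJi.integrableOn, integral_integral_swap hKi, hY]
    simp only
    rw [← integral_sub (integrable_twisted hpm hpb hfm hf2 s₂)
      (integrable_twisted hpm hpb hfm hf2 s₁)]
    simp_rw [hpt]
    rw [integral_add hR (hJi.indicator measurableSet_Ico),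
      integral_indicator measurableSet_Ico, integral_Ico_eq_integral_Ioc]
  refine ⟨Y, IsRep.of_primitive (g := G) hy fun s => ?_⟩
  rcases le_total 0 s with hs | hs
  · rw [← hinc 0 s hs]
    ring
  · rw [intervalIntegral.integral_symm, ← hinc s 0 hs]
    ring

end Invariance

theorem half_ofReal_mul {c d : ℝ} (h : c = 2 * d) (n : ℝ≥0∞) :
    2⁻¹ * (ENNReal.ofReal c * n) = ENNReal.ofReal d * n := by
  rw [← mul_assoc, h, ENNReal.ofReal_mul (by norm_num), ← mul_assoc]
  norm_num [ENNReal.inv_mul_cancel]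

/-! ### The operator `V 𝒯(ψ_a) V` -/

section Composition

variable {a : ℝ}

theorem isHilbertSchmidt_of_hsSum_le {B : L2 →L[ℂ] L2} {d : ℝ} (hd : 0 ≤ d)
    (h : hsSum (stdBasis L2) B ≤ ENNReal.ofReal (d ^ 2)) :
    IsHilbertSchmidt B ∧ hsNorm B ≤ d := by
  refine ⟨h.trans_lt ENNReal.ofReal_lt_top, ?_⟩
  unfold hsNorm
  rw [← Real.sqrt_sq hd]
  refine Real.sqrt_le_sqrt ?_
  rw [← ENNReal.toReal_ofReal (sq_nonneg d)]
  exact ENNReal.toReal_mono ENNReal.ofReal_ne_top h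

/-- With `f` bounded by `C`, the row at `-s` has squared norm at most `½ C² ‖v‖²` whatever `s` is,
and the weight `‖v s‖²` then integrates to a second `‖v‖²`. -/
theorem lintegral_mul_actionKernel_neg_le {f v : ℝ → ℂ} {C : ℝ≥0∞} (hC : C ≠ ∞)
    (hf : ∀ᵐ t, ‖f t‖ₑ ≤ C) :
    ∫⁻ s, ∫⁻ u, ‖v s * actionKernel f v (-s) u‖ₑ ^ 2
      ≤ 2⁻¹ * C ^ 2 * (∫⁻ t, ‖v t‖ₑ ^ 2) * ∫⁻ t, ‖v t‖ₑ ^ 2 := by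
  have h1 : ∀ s, ∫⁻ u, ‖v s * actionKernel f v (-s) u‖ₑ ^ 2
      ≤ ‖v s‖ₑ ^ 2 * (2⁻¹ * C ^ 2 * ∫⁻ t, ‖v t‖ₑ ^ 2) := fun s => by
    simp_rw [enorm_mul, mul_pow]
    rw [lintegral_const_mul' _ _ (by finiteness), lintegral_actionKernel_row, mul_assoc 2⁻¹]
    gcongr
    rw [← lintegral_sub_left_eq_self (fun t => ‖v t‖ₑ ^ 2) (-s),
      ← lintegral_const_mul' _ _ (ENNReal.pow_ne_top hC)]
    refine lintegral_mono_ae ?_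
    filter_upwards [hf] with t ht
    gcongr
  have h2 : ∫⁻ s, ‖v s‖ₑ ^ 2 * (2⁻¹ * C ^ 2 * ∫⁻ t, ‖v t‖ₑ ^ 2)
      ≤ (2⁻¹ * C ^ 2 * ∫⁻ t, ‖v t‖ₑ ^ 2) * ∫⁻ t, ‖v t‖ₑ ^ 2 := by
    -- Pulling the constant out of the integral requires it to be finite, and `v` is not assumed
    -- square integrable here.
    by_cases hv : ∫⁻ t, ‖v t‖ₑ ^ 2 = ∞
    · by_cases hC0 : C = 0
      · simp [hC0]
      · rw [hv, ENNReal.mul_top (mul_ne_zero (by simp) (pow_ne_zero 2 hC0))]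
        simp
    · rw [lintegral_mul_const' _ _ (by finiteness), mul_comm]
  exact (lintegral_mono h1).trans h2

theorem ofReal_psi_bound (v : L2) :
    2⁻¹ * ENNReal.ofReal (1 + 1 / Real.pi) ^ 2 * (∫⁻ t, ‖v t‖ₑ ^ 2) * ∫⁻ t, ‖v t‖ₑ ^ 2
      = ENNReal.ofReal (((Real.pi + 1) / (Real.pi * Real.sqrt 2) * ‖v‖ ^ 2) ^ 2) := by
  have hp := Real.pi_pos
  have e2 : (2 : ℝ≥0∞)⁻¹ = ENNReal.ofReal 2⁻¹ := by
    rw [ENNReal.ofReal_inv_of_pos (by norm_num)]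
    norm_num
  rw [← L2_enorm_sq, ← ofReal_norm, ← ENNReal.ofReal_pow (norm_nonneg _),
    ← ENNReal.ofReal_pow (by positivity), e2, ← ENNReal.ofReal_mul (by norm_num),
    ← ENNReal.ofReal_mul (by positivity), ← ENNReal.ofReal_mul (by positivity)]
  congr 1
  rw [mul_pow, div_pow, mul_pow, Real.sq_sqrt (by norm_num)]
  field_simp

/-- The outer `V` reflects the first variable of the kernel and multiplies by `v`. The constant is
`C/√2` with `C = 1 + 1/π` the bound on `|ψ_a|`. -/
theorem exists_opV_action_psi (ha : 0 < a) {ψ : L1} (h : ∀ ξ, fourierL1 ψ ξ = omega a ξ) (v : L2)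
    (hmem : ∀ x : opA.domain, (action ψ (opV v)).1 x ∈ opA.domain) :
    ∃ B : L2 →L[ℂ] L2,
      (∀ x : opA.domain, B x = (opV v).1 ⟨(action ψ (opV v)).1 x, hmem x⟩) ∧
      IsHilbertSchmidt B ∧
      hsNorm B ≤ (Real.pi + 1) / (Real.pi * Real.sqrt 2) * ‖v‖ ^ 2 := by
  have hK : StronglyMeasurable
      (Function.uncurry fun s u => v s * actionKernel ψ v (-s) u) := by
    have h1 : StronglyMeasurable fun p : ℝ × ℝ => v p.1 :=
      (Lp.stronglyMeasurable v).comp_measurable measurable_fst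
    have h2 : StronglyMeasurable fun p : ℝ × ℝ => actionKernel ψ v (-p.1) p.2 :=
      (stronglyMeasurable_actionKernel (Lp.stronglyMeasurable ψ)
        (Lp.stronglyMeasurable v)).comp_measurable
          (g := fun p : ℝ × ℝ => (-p.1, p.2)) (measurable_fst.neg.prodMk measurable_snd)
    exact h1.mul h2
  have hC : ∀ᵐ t, ‖ψ t‖ₑ ≤ ENNReal.ofReal (1 + 1 / Real.pi) := by
    filter_upwards [ae_eq_of_fourierL1_eq_omega ha h] with t ht
    rw [ht, ← ofReal_norm, norm_mul, Complex.norm_I, one_mul, Complex.norm_real]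
    exact ENNReal.ofReal_le_ofReal (abs_psiFun_le ha t)
  have hN := (lintegral_mul_actionKernel_neg_le (v := v) ENNReal.ofReal_ne_top hC).trans_eq
    (ofReal_psi_bound v)
  obtain ⟨B, hB, hs⟩ := exists_kernelOp hK (hN.trans_lt ENNReal.ofReal_lt_top)
  refine ⟨B, fun x => Lp.ext ?_, isHilbertSchmidt_of_hsSum_le
    (mul_nonneg (div_nonneg (by linarith [Real.pi_pos]) (mul_nonneg Real.pi_pos.le
      (Real.sqrt_nonneg 2))) (sq_nonneg _)) (hs.trans_le hN)⟩
  filter_upwards [hB x, opV_ae v ⟨(action ψ (opV v)).1 x, hmem x⟩,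
    (Measure.measurePreserving_neg (volume : Measure ℝ)).quasiMeasurePreserving.ae_eq_comp
      (action_opV_ae ψ v x)] with s e1 e2 e3
  have e3' : (action ψ (opV v)).1 x (-s)
    = ∫ t, ψ t * (v (-s - t) * (x : L2) (2 * t - -s)) := e3
  rw [e1, e2, e3', integral_action_eq_kernel, ← integral_const_mul]
  simp only [mul_assoc]

end Composition

/-! ### The resolvent of `A` on the imaginary axis -/

section Resolvent

variable {η : ℝ}

/-- The one-sided exponential `1_{r ≥ 0} e^{-ηr}`. -/
noncomputable def expHeaviside (η r : ℝ) : ℂ :=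
  (Set.Ici (0 : ℝ)).indicator (fun r => Complex.exp (-(η * r))) r

theorem measurable_expHeaviside (η : ℝ) : Measurable (expHeaviside η) :=
  Measurable.indicator (by fun_prop) measurableSet_Ici

theorem norm_expHeaviside (η r : ℝ) :
    ‖expHeaviside η r‖ = (Set.Ici (0 : ℝ)).indicator (fun r => Real.exp (-η * r)) r := by
  by_cases h : r ∈ Set.Ici (0 : ℝ)
  · rw [expHeaviside, Set.indicator_of_mem h, Set.indicator_of_mem h, Complex.norm_exp]
    simp
  · rw [expHeaviside, Set.indicator_of_notMem h, Set.indicator_of_notMem h, norm_zero]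

theorem integrable_expHeaviside (hη : 0 < η) : Integrable (expHeaviside η) := by
  rw [← integrable_norm_iff (measurable_expHeaviside η).aestronglyMeasurable]
  simp_rw [norm_expHeaviside]
  rw [integrable_indicator_iff measurableSet_Ici, integrableOn_Ici_iff_integrableOn_Ioi]
  exact integrableOn_exp_mul_Ioi (by linarith) 0

theorem lintegral_expHeaviside_sq (hη : 0 < η) (t : ℝ) :
    ∫⁻ s, ‖expHeaviside η (t - s)‖ₑ ^ 2 = ENNReal.ofReal (1 / (2 * η)) := by
  rw [lintegral_sub_left_eq_self (fun s => ‖expHeaviside η s‖ₑ ^ 2) t]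
  have h1 : ∀ r, ‖expHeaviside η r‖ₑ ^ 2
      = ENNReal.ofReal ((Set.Ici (0 : ℝ)).indicator (fun r => Real.exp (-(2 * η) * r)) r) :=
    fun r => by
    rw [← ofReal_norm, ← ENNReal.ofReal_pow (norm_nonneg _), norm_expHeaviside]
    congr 1
    by_cases h : r ∈ Set.Ici (0 : ℝ)
    · rw [Set.indicator_of_mem h, Set.indicator_of_mem h, ← Real.exp_nat_mul]
      congr 1
      push_cast
      ring
    · rw [Set.indicator_of_notMem h, Set.indicator_of_notMem h]
      norm_num
  have hint : Integrable ((Set.Ici (0 : ℝ)).indicator (fun r => Real.exp (-(2 * η) * r))) := by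
    rw [integrable_indicator_iff measurableSet_Ici, integrableOn_Ici_iff_integrableOn_Ioi]
    exact integrableOn_exp_mul_Ioi (by linarith) 0
  simp_rw [h1]
  rw [← ofReal_integral_eq_lintegral_ofReal hint
    (ae_of_all _ (Set.indicator_nonneg fun _ _ => (Real.exp_pos _).le)),
    integral_indicator measurableSet_Ici, integral_Ici_eq_integral_Ioi,
    integral_exp_mul_Ioi (by linarith)]
  congr 1
  simp

theorem memLp_expHeaviside (hη : 0 < η) (t : ℝ) : MemLp (fun s => expHeaviside η (t - s)) 2 :=
  memLp_two_of_lintegral_lt_top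
    ((measurable_expHeaviside η).comp (measurable_const.sub measurable_id)).aestronglyMeasurable
    (by rw [lintegral_expHeaviside_sq hη]; exact ENNReal.ofReal_lt_top)

theorem integrable_expHeaviside_smul_transl (hη : 0 < η) (w : L2) :
    Integrable fun r => expHeaviside η r • transl (-r) w :=
  (integrable_expHeaviside hη).smul_bdd ‖w‖
    (continuous_transl.comp (continuous_neg.prodMk continuous_const)).aestronglyMeasurable
    (ae_of_all _ fun r => ((transl (-r)).norm_map w).le)

/-- The resolvent `(iη - A)⁻¹ w = -i ∫₀^∞ e^{-ηr} T(-r) w dr`. -/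
noncomputable def resolventA (hη : 0 < η) : L2 →L[ℂ] L2 :=
  LinearMap.mkContinuous
    { toFun := fun w => (-Complex.I) • ∫ r, expHeaviside η r • transl (-r) w
      map_add' := fun w w' => by
        simp_rw [map_add, smul_add]
        rw [integral_add (integrable_expHeaviside_smul_transl hη w)
          (integrable_expHeaviside_smul_transl hη w'), smul_add]
      map_smul' := fun c w => by
        simp_rw [map_smul, RingHom.id_apply, smul_comm (expHeaviside η _) c]
        rw [integral_smul, smul_comm] }
    (∫ r, ‖expHeaviside η r‖) fun w => by
      change ‖(-Complex.I) • ∫ r, expHeaviside η r • transl (-r) w‖ ≤ _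
      rw [norm_smul, norm_neg, Complex.norm_I, one_mul, ← integral_mul_const]
      refine norm_integral_le_of_norm_le ((integrable_expHeaviside hη).norm.mul_const _)
        (ae_of_all _ fun r => ?_)
      rw [norm_smul, LinearIsometry.norm_map]

/-- The continuous representative of `(iη - A)⁻¹ w`. -/
noncomputable def resolventRep (η : ℝ) (w : L2) (t : ℝ) : ℂ :=
  -Complex.I * ∫ s, expHeaviside η (t - s) * w s

theorem resolventA_ae (hη : 0 < η) (w : L2) :
    resolventA hη w =ᵐ[volume] resolventRep η w := by
  have h1 : (∫ r, expHeaviside η r • transl (-r) w : L2)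
      =ᵐ[volume] fun t => ∫ r, expHeaviside η r * w (t - r) := by
    refine integral_L2_ae_eq (K := fun r t => expHeaviside η r * w (t - r))
      (integrable_expHeaviside_smul_transl hη w) ?_ (ae_of_all _ fun r => ?_)
    · exact (((measurable_expHeaviside η).comp measurable_fst).mul
        ((Lp.stronglyMeasurable w).measurable.comp
          (measurable_snd.sub measurable_fst))).stronglyMeasurable
    · filter_upwards [Lp.coeFn_smul (expHeaviside η r) (transl (-r) w), transl_ae (-r) w]
        with t e1 e2
      rw [e1, Pi.smul_apply, e2, smul_eq_mul, sub_eq_add_neg]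
  have h2 : resolventA hη w = (-Complex.I) • ∫ r, expHeaviside η r • transl (-r) w := rfl
  rw [h2]
  filter_upwards [Lp.coeFn_smul (-Complex.I) (∫ r, expHeaviside η r • transl (-r) w), h1]
    with t e1 e2
  rw [e1, Pi.smul_apply, e2, smul_eq_mul, resolventRep,
    ← integral_sub_left_eq_self (fun s => expHeaviside η (t - s) * w s) volume t]
  simp only [sub_sub_cancel]

/-- Cauchy-Schwarz against the exponential, whose squared `L²` norm is `1/(2η)`. A supremum bound is
the useful one, since `V` multiplies by a function that is only in `L²`. -/
theorem norm_resolventRep_le (hη : 0 < η) (w : L2) (t : ℝ) :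
    ‖resolventRep η w t‖ ≤ Real.sqrt (1 / (2 * η)) * ‖w‖ := by
  have h := enorm_integral_mul_sq_le (memLp_expHeaviside hη t) w
  rw [lintegral_expHeaviside_sq hη] at h
  have h2 := ENNReal.toReal_mono (ENNReal.mul_ne_top ENNReal.ofReal_ne_top
    (ENNReal.pow_ne_top enorm_ne_top)) h
  rw [ENNReal.toReal_mul, ENNReal.toReal_pow, ENNReal.toReal_pow, toReal_enorm, toReal_enorm,
    ENNReal.toReal_ofReal (by positivity)] at h2
  rw [resolventRep, norm_mul, norm_neg, Complex.norm_I, one_mul]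
  refine le_of_sq_le_sq ?_ (by positivity)
  rwa [mul_pow, Real.sq_sqrt (by positivity)]

theorem expHeaviside_sub_mul (η t s : ℝ) (y : ℂ) :
    expHeaviside η (t - s) * y
      = Complex.exp (-(η * t)) * (Set.Iic t).indicator (fun s => Complex.exp (η * s) * y) s := by
  by_cases h : s ≤ t
  · rw [expHeaviside, Set.indicator_of_mem (Set.mem_Ici.2 (sub_nonneg.2 h)),
      Set.indicator_of_mem (Set.mem_Iic.2 h), ← mul_assoc, ← Complex.exp_add]
    congr 2
    push_cast
    ring
  · rw [expHeaviside, Set.indicator_of_notMem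
      (show t - s ∉ Set.Ici (0 : ℝ) from mt (fun h' => sub_nonneg.1 h') h),
      Set.indicator_of_notMem (show s ∉ Set.Iic t from h), zero_mul, mul_zero]

theorem integrableOn_exp_mul_L2 (hη : 0 < η) (w : L2) (t : ℝ) :
    IntegrableOn (fun s : ℝ => Complex.exp (η * s) * w s) (Set.Iic t) := by
  rw [← integrable_indicator_iff measurableSet_Iic]
  have h := ((memLp_expHeaviside hη t).integrable_mul (Lp.memLp w)).const_mul
    (Complex.exp (η * t))
  refine h.congr (ae_of_all _ fun s => ?_)
  have e := expHeaviside_sub_mul η t s (w s)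
  simp only [Pi.mul_apply]
  rw [e, ← mul_assoc, ← Complex.exp_add, add_neg_cancel, Complex.exp_zero, one_mul]
  rfl

/-- Factoring `e^{-η(t-s)}` moves the dependence on `t` into a smooth factor and a primitive with
fixed base point, from which absolute continuity and the derivative can be read off. -/
theorem resolventRep_eq (hη : 0 < η) (w : L2) (t : ℝ) :
    resolventRep η w t = -Complex.I * (Complex.exp (-(η * t)) *
      ((∫ s in Set.Iic (0 : ℝ), Complex.exp (η * s) * w s)
        + ∫ s in (0 : ℝ)..t, Complex.exp (η * s) * w s)) := by
  rw [resolventRep, ← intervalIntegral.integral_Iic_sub_Iic (integrableOn_exp_mul_L2 hη w 0)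
    (integrableOn_exp_mul_L2 hη w t), add_sub_cancel, ← integral_const_mul, ← integral_const_mul,
    ← integral_const_mul, ← integral_indicator measurableSet_Iic]
  refine integral_congr_ae (ae_of_all _ fun s => ?_)
  simp only [expHeaviside_sub_mul]
  by_cases h : s ∈ Set.Iic t
  · simp only [Set.indicator_of_mem h]
  · simp only [Set.indicator_of_notMem h, mul_zero]

theorem hasDerivAt_cexp_real_mul (c : ℂ) (t : ℝ) :
    HasDerivAt (fun t : ℝ => Complex.exp (c * t)) (c * Complex.exp (c * t)) t := by
  have h := ((Complex.ofRealCLM.hasDerivAt (x := t)).const_mul c).cexp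
  refine h.congr_deriv ?_
  simp [mul_comm]

theorem locAC_cexp_real_mul (c : ℂ) : LocAC fun t : ℝ => Complex.exp (c * t) :=
  LocAC.of_contDiff ((contDiff_const.mul Complex.ofRealCLM.contDiff).cexp)

theorem isRep_resolventA (hη : 0 < η) (w : L2) :
    IsRep (resolventA hη w) (resolventRep η w) ∧
      deriv (resolventRep η w) =ᵐ[volume] fun t => -η * resolventRep η w t - Complex.I * w t := by
  set g : ℝ → ℂ := fun s => Complex.exp (η * s) * w s with hg
  have hgl : LocallyIntegrable g :=
    fun t => ⟨Set.Iic (t + 1), Iic_mem_nhds (by linarith), integrableOn_exp_mul_L2 hη w _⟩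
  set I₀ : ℂ := ∫ s in Set.Iic (0 : ℝ), g s
  have hrep : resolventRep η w = fun t : ℝ => -Complex.I * (Complex.exp (-η * t) *
      (I₀ + ∫ s in (0 : ℝ)..t, g s)) := by
    funext t
    rw [resolventRep_eq hη w t, neg_mul (η : ℂ)]
  have hAC : LocAC (resolventRep η w) := by
    rw [hrep]
    exact (LocAC.const _).mul ((locAC_cexp_real_mul (-η)).mul
      ((LocAC.const I₀).add (LocAC.primitive hgl 0)))
  have hd : deriv (resolventRep η w) =ᵐ[volume]
      fun t => -η * resolventRep η w t - Complex.I * w t := by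
    filter_upwards [ae_hasDerivAt_primitive hgl 0] with t ht
    have h1 : HasDerivAt (fun t : ℝ => -Complex.I * (Complex.exp (-η * t) *
        (I₀ + ∫ s in (0 : ℝ)..t, g s))) (-Complex.I * (-η * Complex.exp (-η * t) *
        (I₀ + ∫ s in (0 : ℝ)..t, g s) + Complex.exp (-η * t) * g t)) t :=
      ((hasDerivAt_cexp_real_mul (-η) t).mul (ht.const_add I₀)).const_mul (-Complex.I)
    have e : Complex.exp (-η * t) * Complex.exp (η * t) = 1 := by
      rw [← Complex.exp_add]
      simp
    rw [hrep, h1.deriv, hg]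
    linear_combination (-Complex.I * w t) * e
  refine ⟨⟨hAC, resolventA_ae hη w, ?_⟩, hd⟩
  have hL2 : MemLp (resolventRep η w) 2 :=
    (memLp_congr_ae (resolventA_ae hη w)).1 (Lp.memLp _)
  exact ((hL2.const_mul (-(η : ℂ))).sub ((Lp.memLp w).const_mul Complex.I)).ae_eq hd.symm

/-- The product `e^{ηt} f(t)` is constant, so `|f(t)| ≥ |f(0)|` for `t ≤ 0`. Square integrability on
the left half-line forces `f(0) = 0`. -/
theorem eq_zero_of_deriv_eq_neg_mul (hη : 0 < η) {y : L2} {f : ℝ → ℂ} (hf : IsRep y f)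
    (hd : deriv f =ᵐ[volume] fun t => -η * f t) : y = 0 := by
  set h : ℝ → ℂ := fun t => Complex.exp (η * t) * f t with hh
  have hAC : LocAC h := (locAC_cexp_real_mul η).mul hf.locAC
  have hd0 : deriv h =ᵐ[volume] 0 := by
    filter_upwards [hd, hf.locAC.ae_differentiableAt] with t e1 e2
    have e3 := (hasDerivAt_cexp_real_mul η t).mul e2.hasDerivAt
    refine e3.deriv.trans ?_
    rw [e1]
    simp only [Pi.zero_apply]
    ring
  have hconst : ∀ t, h t = f 0 := fun t => by
    have e := hAC.intervalIntegral_deriv ((memLp_congr_ae hd0).2 MemLp.zero') 0 t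
    rw [intervalIntegral.integral_congr_ae (g := fun _ => (0 : ℂ)) (hd0.mono fun s hs _ => hs),
      intervalIntegral.integral_zero] at e
    have h0 : h 0 = f 0 := by simp [hh]
    rw [← h0]
    exact (sub_eq_zero.1 e.symm)
  have hf2 : Integrable fun t => ‖f t‖ ^ 2 :=
    integrable_norm_sq ((memLp_congr_ae hf.ae_eq).1 (Lp.memLp y))
  have hc : f 0 = 0 := by
    by_contra hne
    have hle : ∀ t ∈ Set.Iic (0 : ℝ), ‖f 0‖ ^ 2 ≤ ‖f t‖ ^ 2 := fun t ht => by
      have e : ‖f 0‖ = Real.exp (η * t) * ‖f t‖ := by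
        rw [← hconst t, hh, norm_mul, Complex.norm_exp]
        simp
      refine pow_le_pow_left₀ (norm_nonneg _) ?_ 2
      rw [e]
      exact mul_le_of_le_one_left (norm_nonneg _)
        (Real.exp_le_one_iff.2 (mul_nonpos_of_nonneg_of_nonpos hη.le ht))
    have hi : IntegrableOn (fun _ : ℝ => ‖f 0‖ ^ 2) (Set.Iic (0 : ℝ)) :=
      hf2.integrableOn.mono' aestronglyMeasurable_const ((ae_restrict_iff' measurableSet_Iic).2
        (ae_of_all _ fun t ht => by
          rw [Real.norm_of_nonneg (sq_nonneg _)]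
          exact hle t ht))
    rw [integrableOn_const_iff] at hi
    simp [hne] at hi
  refine Lp.ext ((hf.ae_eq).trans ?_)
  filter_upwards [Lp.coeFn_zero ℂ 2 (volume : Measure ℝ)] with t ht
  rw [ht]
  have e := hconst t
  rw [hc, hh] at e
  simpa [Complex.exp_ne_zero] using e

/-- The equation `(iη - A)y = w` reads `y' = -ηy - iw`, which the convolution solves. The left
inverse follows from the right inverse and the injectivity of `iη - A`. -/
theorem isResolvent_resolventA (hη : 0 < η) :
    IsResolvent opA (η * Complex.I) (resolventA hη) := by
  have hmem : ∀ w, resolventA hη w ∈ opA.domain := fun w => ⟨_, (isRep_resolventA hη w).1⟩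
  have hright : ∀ w, ((η : ℂ) * Complex.I) • resolventA hη w - opA ⟨resolventA hη w, hmem w⟩ = w :=
    fun w => by
    have hA : opA ⟨resolventA hη w, hmem w⟩
      = (-Complex.I) • derivL2 ⟨resolventA hη w, hmem w⟩ := rfl
    rw [hA]
    refine Lp.ext ?_
    filter_upwards [Lp.coeFn_sub (((η : ℂ) * Complex.I) • resolventA hη w)
        ((-Complex.I) • derivL2 ⟨resolventA hη w, hmem w⟩),
      Lp.coeFn_smul ((η : ℂ) * Complex.I) (resolventA hη w),
      Lp.coeFn_smul (-Complex.I) (derivL2 ⟨resolventA hη w, hmem w⟩),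
      derivL2_ae (x := ⟨resolventA hη w, hmem w⟩) (isRep_resolventA hη w).1,
      (isRep_resolventA hη w).2, resolventA_ae hη w] with t e1 e2 e3 e4 e5 e6
    rw [e1, Pi.sub_apply, e2, e3, Pi.smul_apply, Pi.smul_apply, e4, e5, e6, smul_eq_mul,
      smul_eq_mul]
    linear_combination (-w t) * Complex.I_sq
  refine ⟨hmem, hright, fun x => ?_⟩
  set w := ((η : ℂ) * Complex.I) • (x : L2) - opA x with hw
  set y : opA.domain := ⟨resolventA hη w, hmem w⟩ - x with hy
  have hy1 : ((η : ℂ) * Complex.I) • (y : L2) = opA y := by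
    have h1 := hright w
    have h2 : opA y = opA ⟨resolventA hη w, hmem w⟩ - opA x := LinearPMap.map_sub _ _ _
    have h3 : (y : L2) = resolventA hη w - x := rfl
    rw [h2, h3, smul_sub, sub_eq_sub_iff_sub_eq_sub, h1]
  have hyA : opA y = (-Complex.I) • derivL2 y := rfl
  have hy0 : (y : L2) = 0 := by
    refine eq_zero_of_deriv_eq_neg_mul hη (rep_spec y) ?_
    have h4 : derivL2 y = (-(η : ℂ)) • (y : L2) := by
      have h5 := congrArg (fun u => Complex.I • u) hy1
      simp only [hyA, smul_smul] at h5
      rw [mul_neg, Complex.I_mul_I, neg_neg, one_smul] at h5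
      rw [← h5]
      congr 1
      linear_combination (η : ℂ) * Complex.I_sq
    filter_upwards [derivL2_ae (rep_spec y), Lp.coeFn_smul (-(η : ℂ)) (y : L2),
      (rep_spec y).ae_eq] with t e1 e2 e3
    rw [← e1, h4, e2, Pi.smul_apply, e3, smul_eq_mul]
  exact sub_eq_zero.1 hy0

theorem exists_opV_resolventA (hη : 0 < η) (v : L2) :
    ∃ B : L2 →L[ℂ] L2,
      (∀ x : L2, B x = (opV v).1 ⟨resolventA hη x, (isResolvent_resolventA hη).mem_domain x⟩) ∧
      ‖B‖ ≤ Real.sqrt (1 / (2 * η)) * ‖v‖ := by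
  let B₀ : L2 →ₗ[ℂ] L2 := (opV v).1 ∘ₗ
    (resolventA hη).toLinearMap.codRestrict opA.domain (isResolvent_resolventA hη).mem_domain
  have hB : ∀ w, ‖B₀ w‖ ≤ Real.sqrt (1 / (2 * η)) * ‖v‖ * ‖w‖ := fun w => by
    have h : ‖B₀ w‖ ≤ (Real.sqrt (1 / (2 * η)) * ‖w‖) * ‖v‖ := by
      refine Lp.norm_le_mul_norm_of_ae_le_mul ?_
      filter_upwards [opV_ae v ⟨resolventA hη w, (isResolvent_resolventA hη).mem_domain w⟩,
        (Measure.measurePreserving_neg (volume : Measure ℝ)).quasiMeasurePreserving.ae_eq_comp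
          (resolventA_ae hη w)] with t e1 e2
      simp only [Function.comp_apply] at e2
      have e3 : B₀ w t = v t * resolventA hη w (-t) := e1
      rw [e3, e2, norm_mul, mul_comm]
      exact mul_le_mul_of_nonneg_right (norm_resolventRep_le hη w (-t)) (norm_nonneg _)
    linarith
  exact ⟨B₀.mkContinuous _ hB, fun x => rfl, B₀.mkContinuous_norm_le (by positivity) hB⟩

end Resolvent

end ReflPert

/-! ### The five assertions together -/

theorem mainTheorem11 (v : L2) :
    (∀ a : ℝ, 0 < a →
      (∃ B : L2 →L[ℂ] L2, ofBounded opA B = action (phi a) (opV v) ∧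
        IsHilbertSchmidt B ∧ hsNorm B = Real.sqrt (2 * a / (3 * Real.pi)) * ‖v‖) ∧
      (∃ ψ : L1, ∀ ξ : ℝ, fourierL1 ψ ξ = omega a ξ) ∧
      ∀ ψ : L1, (∀ ξ : ℝ, fourierL1 ψ ξ = omega a ξ) →
        (∃ B : L2 →L[ℂ] L2, ofBounded opA B = action ψ (opV v) ∧
          IsHilbertSchmidt B ∧
          hsNorm B = Real.sqrt ((1 - Real.log 2) / (a * Real.pi)) * ‖v‖) ∧
        ∃ h : ∀ x : opA.domain, (action ψ (opV v)).1 x ∈ opA.domain,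
          ∃ B : L2 →L[ℂ] L2,
            (∀ x : opA.domain, B x = (opV v).1 ⟨(action ψ (opV v)).1 x, h x⟩) ∧
            IsHilbertSchmidt B ∧
            hsNorm B ≤ (Real.pi + 1) / (Real.pi * Real.sqrt 2) * ‖v‖ ^ 2) ∧
    (∀ ε : ℝ, 0 < ε → ∃ z : ℂ, z.im ≠ 0 ∧ ∃ R : L2 →L[ℂ] L2, ∃ hR : IsResolvent opA z R,
      ∃ B : L2 →L[ℂ] L2, (∀ x : L2, B x = (opV v).1 ⟨R x, hR.mem_domain x⟩) ∧ ‖B‖ < ε) := by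
  have hpi := Real.pi_pos
  refine ⟨fun a ha => ⟨?_, ⟨psi ha, fourierL1_psi ha⟩, fun ψ hψ => ⟨?_, ?_⟩⟩, fun ε hε => ?_⟩
  · obtain ⟨B, hB, -, hs⟩ := exists_action_opV (phi a) v
      ((lintegral_phi_sq ha).trans_lt ENNReal.ofReal_lt_top)
    refine ⟨B, hB, isHilbertSchmidt_and_hsNorm (by positivity) ?_⟩
    rw [hs, lintegral_phi_sq ha]
    refine half_ofReal_mul ?_ _
    field_simp
    norm_num
  · obtain ⟨B, hB, -, hs⟩ := exists_action_opV ψ v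
      ((lintegral_psi_sq ha hψ).trans_lt ENNReal.ofReal_lt_top)
    have hlog : Real.log 2 ≤ 1 := by linarith [Real.log_two_lt_d9]
    refine ⟨B, hB, isHilbertSchmidt_and_hsNorm
      (div_nonneg (by linarith) (by positivity)) ?_⟩
    rw [hs, lintegral_psi_sq ha hψ]
    refine half_ofReal_mul ?_ _
    field_simp
    ring
  · exact ⟨fun x => action_psi_mem_W12 ha hψ v x,
      exists_opV_action_psi ha hψ v fun x => action_psi_mem_W12 ha hψ v x⟩
  · have hK : 0 < ε / (‖v‖ + 1) := by positivity
    -- With `η = 1/(2κ²)` the factor `√(1/(2η))` is exactly `κ`, and `κ ‖v‖ < ε`. The added `1`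
    -- covers `v = 0` and makes the inequality strict.
    set κ := ε / (‖v‖ + 1) with hκ
    have hη : 0 < 1 / (2 * κ ^ 2) := by positivity
    obtain ⟨B, hB, hn⟩ := exists_opV_resolventA hη v
    refine ⟨(1 / (2 * κ ^ 2) : ℝ) * Complex.I, by
      rw [Complex.mul_I_im, Complex.ofReal_re]
      exact hη.ne', resolventA hη,
      isResolvent_resolventA hη, B, hB, hn.trans_lt ?_⟩
    rw [show 1 / (2 * (1 / (2 * κ ^ 2))) = κ ^ 2 by field_simp, Real.sqrt_sq hK.le, hκ,
      div_mul_eq_mul_div, div_lt_iff₀ (by positivity)]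
    exact mul_lt_mul_of_pos_left (by linarith) hε
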